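/- Let $\rho$ be a two-qubit density matrix of the form $$\rho=\begin{pmatrix}a&0&0&y\\0&b&x&0\\0&\bar x&b&0\\\bar y&0&0&a\end{pmatrix},\qquad a,b\in\mathbb R,\ x,y\in\mathbb C,$$ in the basis $|00\rangle,|01\rangle,|10\rangle,|11\rangle$ of $\mathbb C^2_A\otimes\mathbb C^2_B$, and put $p_{1}=b-|x|$, $p_2=b+|x|$, $p_3=a-|y|$, $p_4=a+|y|$ (the eigenvalues of $\rho$). An $A$-classical state is a state $\sigma=\sum_{i=0}^1 q_i|\alpha_i\rangle\langle\alpha_i|\otimes\tau_i$ with $\{|\alpha_i\rangle\}$ an orthonormal basis of $\mathbb C^2_A$, $q_i\ge 0$, $q_0+q_1=1$, and $\tau_i$ states of $B$; $C_A$ is the set of these states. Let $F(\rho,\sigma)=\big[\mathrm{tr}\sqrt{\sqrt\rho\,\sigma\sqrt\rho}\big]^2$, $d_B(\rho,\sigma)=\sqrt{2(1-\sqrt{F(\rho,\sigma)})}$, $F_A(\rho)=\max_{\sigma\in C_A}F(\rho,\sigma)$ and $D_A(\rho)=\min_{\sigma\in C_A}d_B(\rho,\sigma)^2$; a closest $A$-classical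 state is a $\sigma\in C_A$ attaining this minimum. For an orthonormal basis $\{|\alpha_i\rangle\}$ of $\mathbb C^2_A$ let $\lambda_i=\langle\alpha_i|\rho_A|\alpha_i\rangle$, $\rho_i=\lambda_i^{-1}\sqrt\rho\,(|\alpha_i\rangle\langle\alpha_i|\otimes I)\sqrt\rho$, and $P(\{\alpha_i\})=\sup\sum_i\lambda_i\mathrm{tr}(\Pi_i\rho_i)$ over von Neumann measurements $\{\Pi_0,\Pi_1\}$ on $\mathbb C^2\otimes\mathbb C^2$ with projectors of rank $2$. The measurement $\{|\alpha_0\rangle\langle\alpha_0|,|\alpha_1\rangle\langle\alpha_1|\}$ is called optimal if its basis maximizes $P$ over all orthonormal bases. For a unit vector $u\in\mathbb R^3$ let $M_u=\{\frac12(I+u\cdot\vec\sigma),\frac12(I-u\cdot\vec\sigma)\}$, where $\vec\sigma=(\sigma_1,\sigma_2,\sigma_3)$ are the Pauli matrices. Then the maximum $F_A(\rho)$ and the minimum $D_A(\rho)$ are attained, $F_A(\rho)$ is also the maximum of $P$, and $D_A(\rho)=2(1-\sqrt{F_A(\rho)})$. A basis gives an optimal measurement if and only if some closest $A$-classical state is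 $A$-classical with respect to that basis. Moreover: (i) If $|a-b|>|x|+|y|$, then $F_A(\rho)=\frac12+\sqrt{p_1p_2}+\sqrt{p_3p_4}$, and the only optimal measurement is $\{|0\rangle\langle0|,|1\rangle\langle1|\}=M_{(0,0,1)}$. (ii) If $|a-b|<|x|+|y|$, then $F_A(\rho)=\frac12+\sqrt{p_2p_4}+\sqrt{p_1p_3}$. If $xy\ne0$ and $xy=|xy|e^{i\phi}$, the only optimal measurement is $M_u$ with $u=(\cos\frac\phi2,-\sin\frac\phi2,0)$. If $xy=0$, the optimal measurements are exactly the $M_u$ with $u=(\cos\frac\phi2,-\sin\frac\phi2,0)$, $\phi\in[0,2\pi)$, and there are infinitely many closest $A$-classical states. (iii) If $|a-b|=|x|+|y|$, then $F_A(\rho)=\frac12+\sqrt{p_1p_2}+\sqrt{p_3p_4}=\frac12+\sqrt{p_2p_4}+\sqrt{p_1p_3}$. If $xy\neq0$ and $xy=|xy|e^{i\phi}$, the optimal measurements are exactly the $M_u$ with $u=(\sin\theta\cos\frac\phi2,-\sin\theta\sin\frac\phi2,\cos\theta)$, $\theta\in[0,\pi]$. If $xy=0$, the optimal measurements are exactly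 the $M_u$ with $u=(\sin\theta\cos\frac\phi2,-\sin\theta\sin\frac\phi2,\cos\theta)$, $\theta\in[0,\pi]$, $\phi\in[0,2\pi)$. Unless $x=y=0$, there are infinitely many closest $A$-classical states. -/

import Mathlib

open scoped Kronecker MatrixOrder ComplexOrder

noncomputable section

namespace QDiscord

/-- Operators on one qubit `ℂ²`. -/
abbrev Op1 := Matrix (Fin 2) (Fin 2) ℂ

/-- Operators on the two-qubit space `ℂ² ⊗ ℂ²`; the first index belongs to `A`, the second to `B`. -/
abbrev Op2 := Matrix (Fin 2 × Fin 2) (Fin 2 × Fin 2) ℂ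

/-- Orthonormal bases of the space `ℂ²` of the subsystem `A`. -/
abbrev QubitBasis := OrthonormalBasis (Fin 2) ℂ (EuclideanSpace ℂ (Fin 2))

/-- Density matrices. -/
def IsState {n : Type*} [Fintype n] (ρ : Matrix n n ℂ) : Prop :=
  ρ.PosSemidef ∧ ρ.trace = 1

/-- The rank-one projector `|v⟩⟨v|`. -/
def proj (v : EuclideanSpace ℂ (Fin 2)) : Op1 :=
  Matrix.vecMulVec (fun i => v i) (fun i => star (v i))

/-- `σ = ∑ᵢ pᵢ |αᵢ⟩⟨αᵢ| ⊗ τᵢ` with probabilities `pᵢ` and states `τᵢ` of `B`. -/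
def IsAClassicalIn (α : QubitBasis) (σ : Op2) : Prop :=
  ∃ (p : Fin 2 → ℝ) (τ : Fin 2 → Op1), (∀ i, 0 ≤ p i) ∧ ∑ i, p i = 1 ∧
    (∀ i, IsState (τ i)) ∧ σ = ∑ i, (p i : ℂ) • (proj (α i) ⊗ₖ τ i)

/-- The set of `A`-classical (zero-discord) states. -/
def aClassicalStates : Set Op2 := {σ | ∃ α : QubitBasis, IsAClassicalIn α σ}

/-- The fidelity `F(ρ, σ) = (tr √(√ρ σ √ρ))²`. -/
def fidelity (ρ σ : Op2) : ℝ :=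
  ((CFC.sqrt (CFC.sqrt ρ * σ * CFC.sqrt ρ)).trace.re) ^ 2

/-- The Bures distance `d_B(ρ, σ) = √(2 (1 - √F(ρ, σ)))`. -/
def buresDist (ρ σ : Op2) : ℝ :=
  √(2 * (1 - √(fidelity ρ σ)))

/-- The maximal fidelity `F_A(ρ)` to the `A`-classical states. -/
def maxFidelity (ρ : Op2) : ℝ := sSup (fidelity ρ '' aClassicalStates)

/-- The geometric discord `D_A(ρ)`: the minimal squared Bures distance to the `A`-classical
states. -/
def geometricDiscord (ρ : Op2) : ℝ := sInf ((fun σ => buresDist ρ σ ^ 2) '' aClassicalStates)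

/-- The closest `A`-classical states to `ρ`. -/
def closestStates (ρ : Op2) : Set Op2 :=
  {σ | σ ∈ aClassicalStates ∧ ∀ τ ∈ aClassicalStates, buresDist ρ σ ≤ buresDist ρ τ}

/-- The reduced matrix `ρ_A = tr_B ρ`. -/
def reducedA (ρ : Op2) : Op1 := Matrix.of fun i j => ∑ k, ρ (i, k) (j, k)

/-- The weight `λᵢ = ⟨αᵢ|ρ_A|αᵢ⟩`. -/
def weight (ρ : Op2) (α : QubitBasis) (i : Fin 2) : ℝ :=
  ((fun k => star (α i k)) ⬝ᵥ (reducedA ρ).mulVec (fun k => α i k)).re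

/-- The state `ρᵢ = λᵢ⁻¹ √ρ (|αᵢ⟩⟨αᵢ| ⊗ I) √ρ` of the ensemble. -/
def ensembleState (ρ : Op2) (α : QubitBasis) (i : Fin 2) : Op2 :=
  ((weight ρ α i)⁻¹ : ℂ) • (CFC.sqrt ρ * (proj (α i) ⊗ₖ (1 : Op1)) * CFC.sqrt ρ)

/-- Two-outcome von Neumann measurements on `AB` with orthogonal projectors of rank
`dim B = 2`. -/
def IsVonNeumann (P : Fin 2 → Op2) : Prop :=
  (∀ i, (P i).IsHermitian ∧ P i * P i = P i ∧ (P i).rank = 2) ∧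
    (∀ i j, i ≠ j → P i * P j = 0) ∧ ∑ i, P i = 1

/-- The optimal success probability, over von Neumann measurements, of discriminating the
ensemble `{ρᵢ, λᵢ}` associated with `ρ` and the basis `α`. -/
def optSuccessProb (ρ : Op2) (α : QubitBasis) : ℝ :=
  sSup {r | ∃ P : Fin 2 → Op2, IsVonNeumann P ∧
    r = ∑ i, weight ρ α i * ((P i * ensembleState ρ α i).trace).re}

/-- The basis `α` maximizes the optimal success probability. -/
def IsOptimalBasis (ρ : Op2) (α : QubitBasis) : Prop :=
  ∀ β : QubitBasis, optSuccessProb ρ β ≤ optSuccessProb ρ α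

/-- The von Neumann measurement `{|α₀⟩⟨α₀|, |α₁⟩⟨α₁|}` on `A`. -/
def basisMeasurement (α : QubitBasis) : Set Op1 := Set.range fun i => proj (α i)

/-- The set of optimal measurements on `A`. -/
def optimalMeasurements (ρ : Op2) : Set (Set Op1) :=
  {M | ∃ α : QubitBasis, IsOptimalBasis ρ α ∧ M = basisMeasurement α}

/-- `σ_u = u₁ σ₁ + u₂ σ₂ + u₃ σ₃`, with the Pauli matrices. -/
def pauli (u : Fin 3 → ℝ) : Op1 :=
  (u 0 : ℂ) • !![0, 1; 1, 0] + (u 1 : ℂ) • !![0, -Complex.I; Complex.I, 0] +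
    (u 2 : ℂ) • !![1, 0; 0, -1]

/-- The measurement `{½ (I + σ_u), ½ (I - σ_u)}`. -/
def blochMeasurement (u : Fin 3 → ℝ) : Set Op1 :=
  {(1 / 2 : ℂ) • (1 + pauli u), (1 / 2 : ℂ) • (1 - pauli u)}

/-- The X-shaped matrix with `a = d`, `b = c`, in the basis `|00⟩, |01⟩, |10⟩, |11⟩`. -/
def xState (a b : ℝ) (x y : ℂ) : Op2 :=
  (!![(a : ℂ), 0, 0, y;
      0, (b : ℂ), x, 0;
      0, star x, (b : ℂ), 0;
      star y, 0, 0, (a : ℂ)] : Matrix (Fin 4) (Fin 4) ℂ).submatrix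
    (finProdFinEquiv : Fin 2 × Fin 2 ≃ Fin 4) (finProdFinEquiv : Fin 2 × Fin 2 ≃ Fin 4)

end QDiscord

end

open QDiscord

/-! For a fixed basis the largest fidelity to a state classical in that basis equals the optimal
success probability of the associated discrimination problem, and for these matrices both have a
closed form. Write `ρ = S²` with `S = xState c d p q` again X-shaped. Since `ρ_A` is maximally
mixed, both weights are `1/2`, and weight times ensemble state is `S Aᵢ S` with `Aᵢ = |αᵢ⟩⟨αᵢ| ⊗ 1`.

By `xState_conj`, the difference `S A₀ S - S A₁ S` is a sum of two local terms `v (h·σ ⊗ 1 + 1 ⊗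
w·σ)`, where `v` is `gain`, `|h| = 1` and `|w| ≤ 1` (`IsRoot.exists_direction`). Its positive part
therefore has trace `2v` and lives on the rank-two projector `½(1 + h·σ) ⊗ 1`. That projector and
its complement succeed with probability `1/2 + 2v`. A dual operator `Y` above both `S Aᵢ S`, of
trace `1/2 + 2v`, shows that nothing does better.

The same `Y` bounds the fidelity. If `σ = G Gᴴ` with `G` commuting with the `Aᵢ`, polar
decomposition of `S G`, pinching and Cauchy-Schwarz bound `F(ρ, σ)` by a success expression with
sub-normalised effects, hence by `tr Y` (`sq_trace_sqrt_le`). Compressing `S Pᵢ S` by `Aᵢ`, for the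
optimal projectors `Pᵢ`, gives a classical state attaining the bound (`IsRoot.exists_attaining`).

It remains to maximise `v` over the Bloch sphere. By `sq_two_gain`, `(2v)²` is `planeGain² |ζ|² +
axisGain² z²` minus a nonnegative defect that vanishes exactly when `ζ` has half the phase of `p q`.
The comparison of `axisGain` with `planeGain` is that of `|a - b|` with `|x| + |y|`
(`IsRoot.sq_sub_sq`), which yields the three cases. Infinitely many closest states arise because
suitable optimal bases carry a closest state classical in no other basis
(`IsRoot.exists_correlated`, `bloch_eq_smul_of_isAClassicalIn`). -/

namespace QDiscord

open scoped Matrix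

/-! ### Trace norm, contractions and the duality bound for matrices. -/

section General

variable {n : Type*} [Fintype n] [DecidableEq n]

/-- Every positive semidefinite matrix has a positive semidefinite Moore-Penrose inverse
commuting with it. -/
theorem exists_pseudoInverse {M : Matrix n n ℂ} (hM : M.PosSemidef) :
    ∃ N : Matrix n n ℂ, N.PosSemidef ∧ N * M = M * N ∧ M * N * M = M ∧ N * M * N = N := by
  have hsa : IsSelfAdjoint M := hM.isHermitian
  have hcont : ∀ f : ℝ → ℝ, ContinuousOn f (spectrum ℝ M) := fun f =>
    continuousOn_iff_continuous_domRestrict.2 continuous_of_discreteTopology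
  have hid : cfc (fun t : ℝ => t) M = M := cfc_id' ℝ M
  have h1 : cfc (fun t : ℝ => t⁻¹) M * M = cfc (fun t : ℝ => t⁻¹ * t) M := by
    rw [cfc_mul _ _ M (hcont _) (hcont _), hid]
  have h2 : M * cfc (fun t : ℝ => t⁻¹) M = cfc (fun t : ℝ => t * t⁻¹) M := by
    rw [cfc_mul _ _ M (hcont _) (hcont _), hid]
  refine ⟨cfc (fun t : ℝ => t⁻¹) M, ?_, ?_, ?_, ?_⟩
  · rw [← Matrix.nonneg_iff_posSemidef]
    exact cfc_nonneg fun t ht =>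
      inv_nonneg.2 (spectrum_nonneg_of_nonneg (Matrix.nonneg_iff_posSemidef.2 hM) ht)
  · rw [h1, h2]
    simp only [mul_comm]
  · rw [h2]
    nth_rewrite 2 [← hid]
    rw [← cfc_mul _ _ M (hcont _) (hcont _)]
    simp only [mul_inv_mul_cancel]
    exact hid
  · rw [h1, ← cfc_mul _ _ M (hcont _) (hcont _)]
    congr 1
    ext t
    rcases eq_or_ne t 0 with h | h
    · simp [h]
    · field_simp

theorem posSemidef_sqrt (M : Matrix n n ℂ) : (CFC.sqrt M).PosSemidef :=
  Matrix.nonneg_iff_posSemidef.1 (CFC.sqrt_nonneg M)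

theorem sqrt_mul_sqrt {M : Matrix n n ℂ} (hM : M.PosSemidef) :
    CFC.sqrt M * CFC.sqrt M = M :=
  CFC.sqrt_mul_sqrt_self M (Matrix.nonneg_iff_posSemidef.2 hM)

theorem trace_mul_re_nonneg {E X : Matrix n n ℂ} (hE : E.PosSemidef) (hX : X.PosSemidef) :
    0 ≤ (E * X).trace.re := by
  have h := (hE.mul_mul_conjTranspose_same (CFC.sqrt X)).trace_nonneg
  have hS : (CFC.sqrt X)ᴴ = CFC.sqrt X := (posSemidef_sqrt X).isHermitian
  rw [hS, Matrix.trace_mul_comm, ← Matrix.mul_assoc, sqrt_mul_sqrt hX, Matrix.trace_mul_comm] at h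
  exact (Complex.le_def.1 h).1

/-- The real part of the trace is at most the trace norm. -/
theorem trace_re_le_trace_sqrt (T : Matrix n n ℂ) :
    T.trace.re ≤ (CFC.sqrt (T * Tᴴ)).trace.re := by
  set M := CFC.sqrt (T * Tᴴ) with hMdef
  have hM : M.PosSemidef := posSemidef_sqrt _
  have hMM : M * M = T * Tᴴ := sqrt_mul_sqrt (Matrix.posSemidef_self_mul_conjTranspose T)
  have hMH : Mᴴ = M := hM.isHermitian
  obtain ⟨N, hN, hc, hMNM, hNMN⟩ := exists_pseudoInverse hM
  have hNH : Nᴴ = N := hN.isHermitian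
  -- `M * N` projects onto the range of `M`, which is the range of `T` because `M² = T Tᴴ`.
  have hT : M * N * T = T := by
    have h0 : (T - M * N * T) * (T - M * N * T)ᴴ = 0 := by
      have : (T - M * N * T) * (T - M * N * T)ᴴ
          = T * Tᴴ - M * N * (T * Tᴴ) - (T * Tᴴ) * (N * M) + M * N * (T * Tᴴ) * (N * M) := by
        simp only [Matrix.conjTranspose_sub, Matrix.conjTranspose_mul, hMH, hNH]
        noncomm_ring
      rw [this, ← hMM, hc]
      have e1 : M * N * (M * M) = M * M := by rw [← Matrix.mul_assoc, hMNM]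
      have e2 : M * M * (M * N) = M * M := by
        rw [← hc, ← Matrix.mul_assoc, Matrix.mul_assoc M M N, ← hc, ← Matrix.mul_assoc, hMNM]
      rw [e1, e2]
      simp
    have := Matrix.self_mul_conjTranspose_eq_zero.1 h0
    exact (sub_eq_zero.1 this).symm
  -- Expanding `tr N (T - M)(T - M)ᴴ` gives `2 tr M - 2 Re tr T`, so its positivity is the claim.
  have h := trace_mul_re_nonneg hN (Matrix.posSemidef_self_mul_conjTranspose (T - M))
  have e : N * ((T - M) * (T - M)ᴴ) = N * (T * Tᴴ) - N * M * Tᴴ - N * T * M + N * (M * M) := by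
    simp only [Matrix.conjTranspose_sub, hMH]
    noncomm_ring
  have e1 : (N * (M * M)).trace = M.trace := by rw [← Matrix.mul_assoc, hc, hMNM]
  have e2 : (N * T * M).trace = T.trace := by rw [Matrix.trace_mul_comm, ← Matrix.mul_assoc, hT]
  have e3 : (N * M * Tᴴ).trace = star T.trace := by
    rw [← Matrix.trace_conjTranspose]
    nth_rewrite 2 [← hT]
    rw [Matrix.conjTranspose_mul, Matrix.conjTranspose_mul, hMH, hNH, Matrix.trace_mul_comm]
  rw [e, Matrix.trace_add, Matrix.trace_sub, Matrix.trace_sub, ← hMM, e1, e2, e3] at h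
  simp only [Complex.add_re, Complex.sub_re, Complex.star_def, Complex.conj_re] at h
  linarith

/-- The trace norm is attained at a contraction. -/
theorem exists_contraction (T : Matrix n n ℂ) :
    ∃ C : Matrix n n ℂ, (C * T).trace = (CFC.sqrt (T * Tᴴ)).trace ∧
      (1 - Cᴴ * C).PosSemidef := by
  set M := CFC.sqrt (T * Tᴴ) with hMdef
  have hM : M.PosSemidef := posSemidef_sqrt _
  have hMM : M * M = T * Tᴴ := sqrt_mul_sqrt (Matrix.posSemidef_self_mul_conjTranspose T)
  have hMH : Mᴴ = M := hM.isHermitian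
  obtain ⟨N, hN, hc, hMNM, hNMN⟩ := exists_pseudoInverse hM
  have hNH : Nᴴ = N := hN.isHermitian
  -- The adjoint of the partial isometry in the polar decomposition of `T`; `1 - Cᴴ C` is then the
  -- projection `1 - N M`.
  refine ⟨Tᴴ * N, ?_, ?_⟩
  · rw [Matrix.trace_mul_comm, ← Matrix.mul_assoc, ← hMM, Matrix.mul_assoc, ← hc,
      ← Matrix.mul_assoc, hMNM]
  · have e : (1 : Matrix n n ℂ) - (Tᴴ * N)ᴴ * (Tᴴ * N) = (1 - N * M) * (1 - N * M)ᴴ := by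
      have h1 : (Tᴴ * N)ᴴ * (Tᴴ * N) = N * M := by
        rw [Matrix.conjTranspose_mul, Matrix.conjTranspose_conjTranspose, hNH, Matrix.mul_assoc,
          ← Matrix.mul_assoc T, ← hMM, Matrix.mul_assoc M, ← hc, ← Matrix.mul_assoc,
          ← Matrix.mul_assoc, hNMN]
      have h2 : (N * M)ᴴ = N * M := by rw [Matrix.conjTranspose_mul, hMH, hNH, hc]
      have h3 : N * M * (N * M) = N * M := by rw [← Matrix.mul_assoc, hNMN]
      rw [h1, Matrix.conjTranspose_sub, h2, Matrix.conjTranspose_one, Matrix.mul_sub,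
        Matrix.sub_mul, Matrix.sub_mul, h3]
      simp
    rw [e]
    exact Matrix.posSemidef_self_mul_conjTranspose _

/-- Cauchy-Schwarz for the Frobenius inner product, with one factor normalised. -/
theorem sq_trace_mul_re_le {Z G : Matrix n n ℂ} (hG : (G * Gᴴ).trace = 1) :
    (Z * G).trace.re ^ 2 ≤ (Z * Zᴴ).trace.re := by
  set t : ℝ := (Z * G).trace.re with ht
  have h := (Matrix.posSemidef_self_mul_conjTranspose (Z - (t : ℂ) • Gᴴ)).trace_nonneg
  have h' := (Complex.le_def.1 h).1
  have hG' : (Gᴴ * G).trace = 1 := by rw [Matrix.trace_mul_comm, hG]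
  have e2 : (Gᴴ * Zᴴ).trace = star (Z * G).trace := by
    rw [← Matrix.conjTranspose_mul, Matrix.trace_conjTranspose]
  simp only [Matrix.conjTranspose_sub, Matrix.conjTranspose_smul, Matrix.mul_sub, Matrix.sub_mul,
    Matrix.conjTranspose_conjTranspose, Matrix.smul_mul, Matrix.mul_smul, Matrix.trace_sub,
    Matrix.trace_smul, hG', e2, smul_eq_mul, Complex.star_def, Complex.conj_ofReal,
    Complex.sub_re, Complex.re_ofReal_mul, Complex.conj_re, Complex.zero_re, Complex.one_re,
    ← ht] at h'
  nlinarith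

/-- A bound on the trace norm of `S G`, for `G` commuting with a two-outcome projective
measurement. -/
theorem sq_trace_sqrt_le {S G Y A₀ A₁ : Matrix n n ℂ} (hS : S.IsHermitian)
    (h₀ : A₀.IsHermitian) (h₁ : A₁.IsHermitian) (h₀₀ : A₀ * A₀ = A₀) (h₁₁ : A₁ * A₁ = A₁)
    (h₀₁ : A₀ * A₁ = 0) (h₁₀ : A₁ * A₀ = 0) (hsum : A₀ + A₁ = 1)
    (hG : (G * Gᴴ).trace = 1) (hG₀ : A₀ * G = G * A₀) (hG₁ : A₁ * G = G * A₁)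
    (hY : Y.PosSemidef)
    (hY₀ : (Y - S * A₀ * S).PosSemidef) (hY₁ : (Y - S * A₁ * S).PosSemidef) :
    (CFC.sqrt (S * (G * Gᴴ) * S)).trace.re ^ 2 ≤ Y.trace.re := by
  have hSH : Sᴴ = S := hS
  have h₀H : A₀ᴴ = A₀ := h₀
  have h₁H : A₁ᴴ = A₁ := h₁
  obtain ⟨C, hC, hC1⟩ := exists_contraction (S * G)
  have e : S * G * (S * G)ᴴ = S * (G * Gᴴ) * S := by
    rw [Matrix.conjTranspose_mul, hSH]; noncomm_ring
  rw [e] at hC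
  rw [← hC]
  set K := C * S with hK
  -- Since `G` commutes with the `Aᵢ`, the trace against `G` sees only the block-diagonal part of
  -- `K`. Pinching before Cauchy-Schwarz is what makes the bound sharp.
  set Z := A₀ * K * A₀ + A₁ * K * A₁ with hZ
  have hZG : (Z * G).trace = (C * (S * G)).trace := by
    rw [hZ, Matrix.add_mul, Matrix.mul_assoc (A₀ * K), Matrix.mul_assoc (A₁ * K), hG₀, hG₁,
      Matrix.trace_add, Matrix.trace_mul_comm _ (G * A₀), Matrix.trace_mul_comm _ (G * A₁)]
    have a0 : G * A₀ * (A₀ * K) = G * (A₀ * K) := by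
      rw [Matrix.mul_assoc, ← Matrix.mul_assoc A₀, h₀₀]
    have a1 : G * A₁ * (A₁ * K) = G * (A₁ * K) := by
      rw [Matrix.mul_assoc, ← Matrix.mul_assoc A₁, h₁₁]
    rw [a0, a1, ← Matrix.trace_add, ← Matrix.mul_add, ← Matrix.add_mul, hsum, Matrix.one_mul,
      Matrix.trace_mul_comm, hK, Matrix.mul_assoc]
  rw [← hZG]
  refine (sq_trace_mul_re_le hG).trans ?_
  have key : ∀ A : Matrix n n ℂ, A * A = A →
      (A * K * A * (A * Kᴴ * A)).trace = (Cᴴ * A * C * (S * A * S)).trace := by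
    intro A hA
    have : A * K * A * (A * Kᴴ * A) = A * (C * S * (A * A) * S * Cᴴ * A) := by
      rw [hK, Matrix.conjTranspose_mul, hSH]; noncomm_ring
    rw [this, hA, Matrix.trace_mul_comm, Matrix.mul_assoc _ A A, hA, Matrix.mul_assoc _ Cᴴ A,
      Matrix.trace_mul_comm]
    simp only [Matrix.mul_assoc]
  have hZZ : (Z * Zᴴ).trace
      = (Cᴴ * A₀ * C * (S * A₀ * S)).trace + (Cᴴ * A₁ * C * (S * A₁ * S)).trace := by
    rw [← key A₀ h₀₀, ← key A₁ h₁₁, ← Matrix.trace_add]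
    have : Zᴴ = A₀ * Kᴴ * A₀ + A₁ * Kᴴ * A₁ := by
      rw [hZ]; simp only [Matrix.conjTranspose_add, Matrix.conjTranspose_mul, h₀H, h₁H,
        Matrix.mul_assoc]
    have c1 : A₀ * K * A₀ * (A₁ * Kᴴ * A₁) = 0 := by
      rw [show A₀ * K * A₀ * (A₁ * Kᴴ * A₁) = A₀ * K * (A₀ * A₁) * (Kᴴ * A₁) by noncomm_ring, h₀₁]
      simp
    have c2 : A₁ * K * A₁ * (A₀ * Kᴴ * A₀) = 0 := by
      rw [show A₁ * K * A₁ * (A₀ * Kᴴ * A₀) = A₁ * K * (A₁ * A₀) * (Kᴴ * A₀) by noncomm_ring, h₁₀]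
      simp
    rw [this, hZ, Matrix.add_mul, Matrix.mul_add, Matrix.mul_add, c1, c2]
    simp
  have hE : ∀ A : Matrix n n ℂ, A.IsHermitian → A * A = A → (Cᴴ * A * C).PosSemidef := by
    intro A hA hAA
    have : Cᴴ * A * C = (A * C)ᴴ * (A * C) := by
      rw [Matrix.conjTranspose_mul, hA.eq, Matrix.mul_assoc Cᴴ A (A * C), ← Matrix.mul_assoc A A,
        hAA, Matrix.mul_assoc]
    rw [this]
    exact Matrix.posSemidef_conjTranspose_mul_self _
  -- The operators `Cᴴ Aᵢ C` act as effects with sum `Cᴴ C ≤ 1`; the missing part costs nothing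
  -- because `Y` is positive.
  have b0 := trace_mul_re_nonneg (hE A₀ h₀ h₀₀) hY₀
  have b1 := trace_mul_re_nonneg (hE A₁ h₁ h₁₁) hY₁
  have b2 := trace_mul_re_nonneg hC1 hY
  have e3 : (Cᴴ * A₀ * C * Y).trace.re + (Cᴴ * A₁ * C * Y).trace.re = (Cᴴ * C * Y).trace.re := by
    rw [← Complex.add_re, ← Matrix.trace_add, ← Matrix.add_mul, ← Matrix.add_mul, ← Matrix.mul_add,
      hsum, Matrix.mul_one]
  rw [Matrix.mul_sub, Matrix.trace_sub, Complex.sub_re] at b0 b1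
  rw [Matrix.sub_mul, Matrix.trace_sub, Complex.sub_re, Matrix.one_mul] at b2
  rw [hZZ, Complex.add_re]
  linarith

/-- A lower bound on the trace of `√(S σ S)`. -/
theorem sq_le_sq_trace_sqrt {S G : Matrix n n ℂ} (hS : S.IsHermitian)
    (h : 0 ≤ (S * G).trace.re) :
    (S * G).trace.re ^ 2 ≤ (CFC.sqrt (S * (G * Gᴴ) * S)).trace.re ^ 2 := by
  have e : S * G * (S * G)ᴴ = S * (G * Gᴴ) * S := by
    rw [Matrix.conjTranspose_mul, hS.eq]; noncomm_ring
  have := trace_re_le_trace_sqrt (S * G)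
  rw [e] at this
  exact pow_le_pow_left₀ h this 2

/-- A measurement bound: effects `E₀, E₁` summing to one against operators below `Y`. -/
theorem trace_add_trace_le {E₀ E₁ L₀ L₁ Y : Matrix n n ℂ} (h₀ : E₀.PosSemidef)
    (h₁ : E₁.PosSemidef) (hsum : E₀ + E₁ = 1) (hY₀ : (Y - L₀).PosSemidef)
    (hY₁ : (Y - L₁).PosSemidef) :
    (E₀ * L₀).trace.re + (E₁ * L₁).trace.re ≤ Y.trace.re := by
  have b0 := trace_mul_re_nonneg h₀ hY₀
  have b1 := trace_mul_re_nonneg h₁ hY₁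
  have e3 : (E₀ * Y).trace.re + (E₁ * Y).trace.re = Y.trace.re := by
    rw [← Complex.add_re, ← Matrix.trace_add, ← Matrix.add_mul, hsum, Matrix.one_mul]
  rw [Matrix.mul_sub, Matrix.trace_sub, Complex.sub_re] at b0 b1
  linarith

theorem posSemidef_of_isHermitian_of_mul_self {P : Matrix n n ℂ} (h : P.IsHermitian)
    (hP : P * P = P) : P.PosSemidef := by
  have : P = Pᴴ * P := by rw [h.eq, hP]
  rw [this]
  exact Matrix.posSemidef_conjTranspose_mul_self P

end General

/-! ### Bloch parametrisation of qubit projectors. -/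

section Bloch

/-- The traceless Hermitian matrix with upper right entry `ζ` and diagonal `z, -z`. -/
def bloch (ζ : ℂ) (z : ℝ) : Op1 := !![(z : ℂ), ζ; star ζ, -(z : ℂ)]

/-- The complex coordinate is `ζ = u₁ - i u₂`, which is the source of the minus sign before `sin (φ
/ 2)` in the optimal directions. -/
theorem pauli_eq_bloch (u : Fin 3 → ℝ) :
    pauli u = bloch ((u 0 : ℂ) - (u 1 : ℂ) * Complex.I) (u 2) := by
  ext i j
  fin_cases i <;> fin_cases j <;> simp [pauli, bloch] <;> ring

theorem bloch_isHermitian (ζ : ℂ) (z : ℝ) : (bloch ζ z).IsHermitian := by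
  ext i j
  fin_cases i <;> fin_cases j <;> simp [bloch, Matrix.conjTranspose_apply]

theorem bloch_mul_self (ζ : ℂ) (z : ℝ) :
    bloch ζ z * bloch ζ z = ((Complex.normSq ζ + z ^ 2 : ℝ) : ℂ) • (1 : Op1) := by
  have h := Complex.mul_conj ζ
  ext i j
  fin_cases i <;> fin_cases j <;> simp [bloch, Matrix.mul_apply, Fin.sum_univ_two, ← h] <;> ring

theorem trace_bloch (ζ : ℂ) (z : ℝ) : (bloch ζ z).trace = 0 := by
  simp [bloch, Matrix.trace_fin_two]

theorem bloch_neg (ζ : ℂ) (z : ℝ) : bloch (-ζ) (-z) = -bloch ζ z := by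
  ext i j
  fin_cases i <;> fin_cases j <;> simp [bloch]

theorem bloch_smul (t : ℝ) (ζ : ℂ) (z : ℝ) : bloch (t * ζ) (t * z) = (t : ℂ) • bloch ζ z := by
  ext i j
  fin_cases i <;> fin_cases j <;> simp [bloch]

/-- The projector `½ (1 + bloch ζ z)`. -/
noncomputable def halfPlus (ζ : ℂ) (z : ℝ) : Op1 := (1 / 2 : ℂ) • (1 + bloch ζ z)

theorem halfPlus_isHermitian (ζ : ℂ) (z : ℝ) : (halfPlus ζ z).IsHermitian := by
  unfold halfPlus
  have : ((1 : Op1) + bloch ζ z).IsHermitian := Matrix.isHermitian_one.add (bloch_isHermitian ζ z)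
  rw [Matrix.IsHermitian, Matrix.conjTranspose_smul, this.eq]
  simp

theorem halfPlus_mul_self {ζ : ℂ} {z : ℝ} (h : Complex.normSq ζ + z ^ 2 = 1) :
    halfPlus ζ z * halfPlus ζ z = halfPlus ζ z := by
  have e := bloch_mul_self ζ z
  rw [h] at e
  unfold halfPlus
  simp only [Matrix.smul_mul, Matrix.mul_smul, Matrix.add_mul, Matrix.mul_add, Matrix.one_mul,
    Matrix.mul_one, e]
  module

theorem halfPlus_add_neg (ζ : ℂ) (z : ℝ) : halfPlus ζ z + halfPlus (-ζ) (-z) = 1 := by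
  unfold halfPlus
  rw [bloch_neg]
  module

theorem halfPlus_sub_neg (ζ : ℂ) (z : ℝ) : halfPlus ζ z - halfPlus (-ζ) (-z) = bloch ζ z := by
  unfold halfPlus
  rw [bloch_neg]
  module

theorem halfPlus_neg (ζ : ℂ) (z : ℝ) : halfPlus (-ζ) (-z) = 1 - halfPlus ζ z :=
  eq_sub_of_add_eq' (halfPlus_add_neg ζ z)

theorem halfPlus_mul_neg {ζ : ℂ} {z : ℝ} (h : Complex.normSq ζ + z ^ 2 = 1) :
    halfPlus ζ z * halfPlus (-ζ) (-z) = 0 := by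
  rw [halfPlus_neg, Matrix.mul_sub, halfPlus_mul_self h]
  simp

theorem trace_halfPlus (ζ : ℂ) (z : ℝ) : (halfPlus ζ z).trace = 1 := by
  simp [halfPlus, trace_bloch]

/-- `1 + bloch ζ z` is positive for a Bloch vector in the unit ball. -/
theorem posSemidef_halfPlus {ζ : ℂ} {z : ℝ} (h : Complex.normSq ζ + z ^ 2 ≤ 1) :
    (halfPlus ζ z).PosSemidef := by
  have e : halfPlus ζ z = halfPlus ζ z * (halfPlus ζ z)ᴴ +
      (((1 - (Complex.normSq ζ + z ^ 2)) / 4 : ℝ) : ℂ) • (1 : Op1) := by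
    rw [(halfPlus_isHermitian ζ z).eq]
    unfold halfPlus
    simp only [Matrix.smul_mul, Matrix.mul_smul, Matrix.add_mul, Matrix.mul_add, Matrix.one_mul,
      Matrix.mul_one, bloch_mul_self]
    push_cast
    module
  rw [e]
  refine (Matrix.posSemidef_self_mul_conjTranspose _).add (Matrix.PosSemidef.one.smul ?_)
  exact_mod_cast (by linarith : (0 : ℝ) ≤ (1 - (Complex.normSq ζ + z ^ 2)) / 4)

/-- The measurement with Bloch vector `(ζ, z)`. -/
def blochPair (ζ : ℂ) (z : ℝ) : Set Op1 := {halfPlus ζ z, halfPlus (-ζ) (-z)}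

theorem blochPair_neg (ζ : ℂ) (z : ℝ) : blochPair (-ζ) (-z) = blochPair ζ z := by
  unfold blochPair
  rw [neg_neg, neg_neg, Set.pair_comm]

theorem blochMeasurement_eq (u : Fin 3 → ℝ) :
    blochMeasurement u = blochPair ((u 0 : ℂ) - (u 1 : ℂ) * Complex.I) (u 2) := by
  unfold blochMeasurement blochPair halfPlus
  rw [pauli_eq_bloch, bloch_neg, sub_eq_add_neg (1 : Op1)]

end Bloch

/-! ### Correspondence between orthonormal bases and points of the Bloch sphere. -/

section Basis

/-- `α` is a basis whose projectors have Bloch vectors `±(ζ, z)`. -/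
def HasBloch (α : QubitBasis) (ζ : ℂ) (z : ℝ) : Prop :=
  Complex.normSq ζ + z ^ 2 = 1 ∧ proj (α 0) = halfPlus ζ z ∧ proj (α 1) = halfPlus (-ζ) (-z)

theorem HasBloch.basisMeasurement_eq {α : QubitBasis} {ζ : ℂ} {z : ℝ} (h : HasBloch α ζ z) :
    basisMeasurement α = blochPair ζ z := by
  unfold basisMeasurement blochPair
  ext M
  simp only [Set.mem_range, Fin.exists_fin_two, h.2.1, h.2.2, Set.mem_insert_iff,
    Set.mem_singleton_iff, eq_comm]

theorem sum_proj (α : QubitBasis) : proj (α 0) + proj (α 1) = 1 := by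
  set U : Op1 := Matrix.of fun i j => α i j with hU
  have h : U * Uᴴ = 1 := by
    ext i j
    have := (orthonormal_iff_ite.1 α.orthonormal) j i
    rw [EuclideanSpace.inner_eq_star_dotProduct] at this
    rw [Matrix.mul_apply, Matrix.one_apply]
    simpa [hU, dotProduct, eq_comm] using this
  have h' := mul_eq_one_comm.1 h
  ext k l
  have := congrFun (congrFun h' l) k
  rw [Matrix.mul_apply, Fin.sum_univ_two] at this
  simp only [hU, Matrix.conjTranspose_apply, Matrix.of_apply] at this
  simp only [proj, Matrix.add_apply, Matrix.vecMulVec_apply]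
  rw [mul_comm, mul_comm (α 1 k), this, Matrix.one_apply, Matrix.one_apply]
  simp only [eq_comm]

theorem exists_hasBloch (α : QubitBasis) : ∃ ζ z, HasBloch α ζ z := by
  have hn : Complex.normSq (α 0 0) + Complex.normSq (α 0 1) = 1 := by
    have := α.orthonormal.1 0
    rw [EuclideanSpace.norm_eq, Real.sqrt_eq_one, Fin.sum_univ_two] at this
    simpa [Complex.normSq_eq_norm_sq] using this
  have hp : proj (α 0) = halfPlus (2 * α 0 0 * star (α 0 1))
      (Complex.normSq (α 0 0) - Complex.normSq (α 0 1)) := by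
    have h0 := Complex.mul_conj (α 0 0)
    have h1 := Complex.mul_conj (α 0 1)
    have hn' : (Complex.normSq (α 0 0) : ℂ) + Complex.normSq (α 0 1) = 1 := by exact_mod_cast hn
    ext i j
    fin_cases i <;> fin_cases j <;>
      simp [proj, halfPlus, bloch, Matrix.vecMulVec_apply, h0, h1] <;>
      first | linear_combination (1 / 2 : ℂ) * hn' | ring_nf
  refine ⟨2 * α 0 0 * star (α 0 1), Complex.normSq (α 0 0) - Complex.normSq (α 0 1), ?_, hp, ?_⟩
  · simp only [Complex.normSq_mul, Complex.star_def, Complex.normSq_conj]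
    have : Complex.normSq 2 = 4 := by norm_num [Complex.normSq_apply]
    rw [this]
    linear_combination (Complex.normSq (α 0 0) + Complex.normSq (α 0 1) + 1) * hn
  · rw [halfPlus_neg, ← hp]
    exact eq_sub_of_add_eq' (sum_proj α)

theorem exists_basis_hasBloch {ζ : ℂ} {z : ℝ} (h : Complex.normSq ζ + z ^ 2 = 1) :
    ∃ α : QubitBasis, HasBloch α ζ z := by
  have hz1 : 0 ≤ 1 + z := by nlinarith [Complex.normSq_nonneg ζ]
  have hz2 : 0 ≤ 1 - z := by nlinarith [Complex.normSq_nonneg ζ]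
  set c : ℝ := √((1 + z) / 2) with hc
  have hcc : c * c = (1 + z) / 2 := Real.mul_self_sqrt (by linarith)
  obtain ⟨s, hs1, hs2⟩ : ∃ s : ℂ, (c : ℂ) * star s = ζ / 2 ∧ Complex.normSq s = (1 - z) / 2 := by
    -- `(c, s)` is the first basis vector. At the south pole `c = 0` and the phase of `s` is free,
    -- so `s = 1` is taken; otherwise `c * star s = ζ / 2` determines it.
    rcases eq_or_ne c 0 with h0 | h0
    · have hz : z = -1 := by rw [h0] at hcc; linarith
      have hζ : ζ = 0 := Complex.normSq_eq_zero.1 (by rw [hz] at h; linarith)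
      exact ⟨1, by simp [h0, hζ], by simp [hz]⟩
    · have hc' : (c : ℂ) ≠ 0 := by exact_mod_cast h0
      refine ⟨star ζ / (2 * c), ?_, ?_⟩
      · simp only [Complex.star_def, map_div₀, map_mul, Complex.conj_conj, Complex.conj_ofReal,
          Complex.conj_ofNat]
        field_simp
      · have h4 : Complex.normSq (2 * c) = 2 * (1 + z) := by
          rw [Complex.normSq_mul, Complex.normSq_ofReal, hcc]
          norm_num [Complex.normSq_apply]
          ring
        have h5 : 1 + z ≠ 0 := by
          intro h6
          rw [h6] at hcc
          exact h0 (by nlinarith)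
        rw [Complex.normSq_div, h4, Complex.star_def, Complex.normSq_conj]
        field_simp
        linear_combination h
  have hs3 := Complex.mul_conj s
  have hcc' : (c : ℂ) * c = (1 + z) / 2 := by exact_mod_cast hcc
  have hs4 : (Complex.normSq s : ℂ) = (1 - z) / 2 := by rw [hs2]; push_cast; ring
  rw [hs4] at hs3
  have hs5 : s * (c : ℂ) = star ζ / 2 := by
    have := congrArg star hs1
    simpa [mul_comm] using this
  let v : Fin 2 → EuclideanSpace ℂ (Fin 2) := ![!₂[(c : ℂ), s], !₂[-star s, (c : ℂ)]]
  have hon : Orthonormal ℂ v := by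
    rw [orthonormal_iff_ite]
    intro i j
    rw [EuclideanSpace.inner_eq_star_dotProduct]
    fin_cases i <;> fin_cases j <;> simp [v, dotProduct]
    · linear_combination hcc' + hs3
    · ring
    · ring
    · linear_combination hcc' + hs3
  let α : QubitBasis := OrthonormalBasis.mk hon
    (hon.linearIndependent.span_eq_top_of_card_eq_finrank (by simp)).ge
  have hα : α 0 = !₂[(c : ℂ), s] := by simp [α, v]
  have hp : proj (α 0) = halfPlus ζ z := by
    rw [hα]
    ext i j
    fin_cases i <;> fin_cases j <;> simp [proj, halfPlus, bloch, Matrix.vecMulVec_apply]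
    · linear_combination hcc'
    · rw [Complex.star_def] at hs1; linear_combination hs1
    · rw [Complex.star_def] at hs5; linear_combination hs5
    · linear_combination hs3
  refine ⟨α, h, hp, ?_⟩
  rw [halfPlus_neg, ← hp]
  exact eq_sub_of_add_eq' (sum_proj α)

end Basis

/-! ### X-shaped matrices: square roots, positivity, spectrum. -/

section XState

theorem xState_entries (a b : ℝ) (x y : ℂ) :
    xState a b x y (0, 0) (0, 0) = a ∧ xState a b x y (0, 0) (0, 1) = 0 ∧
    xState a b x y (0, 0) (1, 0) = 0 ∧ xState a b x y (0, 0) (1, 1) = y ∧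
    xState a b x y (0, 1) (0, 0) = 0 ∧ xState a b x y (0, 1) (0, 1) = b ∧
    xState a b x y (0, 1) (1, 0) = x ∧ xState a b x y (0, 1) (1, 1) = 0 ∧
    xState a b x y (1, 0) (0, 0) = 0 ∧ xState a b x y (1, 0) (0, 1) = (starRingEnd ℂ) x ∧
    xState a b x y (1, 0) (1, 0) = b ∧ xState a b x y (1, 0) (1, 1) = 0 ∧
    xState a b x y (1, 1) (0, 0) = (starRingEnd ℂ) y ∧ xState a b x y (1, 1) (0, 1) = 0 ∧
    xState a b x y (1, 1) (1, 0) = 0 ∧ xState a b x y (1, 1) (1, 1) = a := by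
  refine ⟨?_, ?_, ?_, ?_, ?_, ?_, ?_, ?_, ?_, ?_, ?_, ?_, ?_, ?_, ?_, ?_⟩ <;> rfl

theorem xState_isHermitian (a b : ℝ) (x y : ℂ) : (xState a b x y).IsHermitian := by
  ext ⟨i, j⟩ ⟨k, l⟩
  fin_cases i <;> fin_cases j <;> fin_cases k <;> fin_cases l <;>
    simp [xState_entries, Matrix.conjTranspose_apply]

theorem xState_mul_self (c d : ℝ) (p q : ℂ) :
    xState c d p q * xState c d p q =
      xState (c ^ 2 + Complex.normSq q) (d ^ 2 + Complex.normSq p) (2 * d * p) (2 * c * q) := by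
  have hp := Complex.mul_conj p
  have hq := Complex.mul_conj q
  ext ⟨i, j⟩ ⟨k, l⟩
  fin_cases i <;> fin_cases j <;> fin_cases k <;> fin_cases l <;>
    simp [xState_entries, Matrix.mul_apply, Fintype.sum_prod_type, Fin.sum_univ_two, ← hp,
      ← hq, Complex.conj_ofNat] <;> ring

theorem trace_xState (a b : ℝ) (x y : ℂ) : (xState a b x y).trace = 2 * (a + b) := by
  simp [Matrix.trace, Fintype.sum_prod_type, Fin.sum_univ_two, xState_entries]
  ring

/-- The square root of the block `!![a, y; star y, a]`. -/
theorem exists_block_root {a : ℝ} {y : ℂ} (h : ‖y‖ ≤ a) :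
    ∃ (c : ℝ) (q : ℂ), ‖q‖ ≤ c ∧ a = c ^ 2 + Complex.normSq q ∧ y = 2 * c * q := by
  have h3 : 0 ≤ a - ‖y‖ := by linarith
  have h4 : 0 ≤ a + ‖y‖ := by linarith [norm_nonneg y]
  set r := √(a - ‖y‖) with hr
  set s := √(a + ‖y‖) with hs
  have hrr : r * r = a - ‖y‖ := Real.mul_self_sqrt h3
  have hss : s * s = a + ‖y‖ := Real.mul_self_sqrt h4
  have hr0 : 0 ≤ r := Real.sqrt_nonneg _
  have hs0 : 0 ≤ s := Real.sqrt_nonneg _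
  have hrs : r ≤ s := Real.sqrt_le_sqrt (by linarith [norm_nonneg y])
  rcases eq_or_ne (r + s) 0 with h0 | h0
  · have hr' : r = 0 := by linarith
    have hs' : s = 0 := by linarith
    rw [hr'] at hrr
    rw [hs'] at hss
    have hy : ‖y‖ = 0 := by linarith
    have ha : a = 0 := by linarith
    exact ⟨0, 0, by simp, by simp [ha], by simpa using hy⟩
  · have hpos : 0 < r + s := lt_of_le_of_ne (by linarith) (Ne.symm h0)
    -- The block has eigenvalues `r²` and `s²`, so its root has eigenvalues `r` and `s`, that is,
    -- diagonal `(r + s) / 2` and off-diagonal modulus `(s - r) / 2`. Here `‖y‖ = (s² - r²) / 2`.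
    have hn : ‖y / ((r + s : ℝ) : ℂ)‖ = (s - r) / 2 := by
      rw [norm_div, Complex.norm_real, Real.norm_of_nonneg hpos.le, div_eq_iff h0]
      nlinarith
    refine ⟨(r + s) / 2, y / ((r + s : ℝ) : ℂ), ?_, ?_, ?_⟩
    · rw [hn]; linarith
    · rw [Complex.normSq_eq_norm_sq, hn]; nlinarith
    · have : ((r + s : ℝ) : ℂ) ≠ 0 := by exact_mod_cast h0
      push_cast at this ⊢
      field_simp

theorem xState_posSemidef {a b : ℝ} {x y : ℂ} (hx : ‖x‖ ≤ b) (hy : ‖y‖ ≤ a) :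
    (xState a b x y).PosSemidef := by
  obtain ⟨c, q, -, rfl, rfl⟩ := exists_block_root hy
  obtain ⟨d, p, -, rfl, rfl⟩ := exists_block_root hx
  rw [← xState_mul_self]
  nth_rewrite 1 [← (xState_isHermitian c d p q).eq]
  exact Matrix.posSemidef_conjTranspose_mul_self _

/-- An X-shaped matrix splits into two `2 × 2` principal blocks, each with nonnegative diagonal and
determinant. -/
theorem norm_le_of_xState_posSemidef {a b : ℝ} {x y : ℂ} (h : (xState a b x y).PosSemidef) :
    ‖x‖ ≤ b ∧ ‖y‖ ≤ a := by
  have key : ∀ {t : ℝ} {w : ℂ}, (!![(t : ℂ), w; star w, t] : Op1).PosSemidef → ‖w‖ ≤ t := by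
    intro t w ht
    have h0 : 0 ≤ t := by
      have := ht.diag_nonneg (i := 0)
      simpa using this
    have h1 := ht.det_nonneg
    rw [Matrix.det_fin_two_of, Complex.star_def, Complex.mul_conj, Complex.normSq_eq_norm_sq] at h1
    have h2 : 0 ≤ t * t - ‖w‖ ^ 2 := by exact_mod_cast h1
    exact le_of_sq_le_sq (by nlinarith) h0
  constructor
  · apply key
    convert h.submatrix (![(0, 1), (1, 0)] : Fin 2 → Fin 2 × Fin 2) using 1
    ext i j
    fin_cases i <;> fin_cases j <;> simp [xState_entries]
  · apply key
    convert h.submatrix (![(0, 0), (1, 1)] : Fin 2 → Fin 2 × Fin 2) using 1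
    ext i j
    fin_cases i <;> fin_cases j <;> simp [xState_entries]

theorem sqrt_xState {c d : ℝ} {p q : ℂ} (hp : ‖p‖ ≤ d) (hq : ‖q‖ ≤ c) :
    CFC.sqrt (xState (c ^ 2 + Complex.normSq q) (d ^ 2 + Complex.normSq p) (2 * d * p)
      (2 * c * q)) = xState c d p q :=
  CFC.sqrt_unique (xState_mul_self c d p q)
    (Matrix.nonneg_iff_posSemidef.2 (xState_posSemidef hp hq))

theorem charpoly_xState (a b : ℝ) (x y : ℂ) :
    (xState a b x y).charpoly = (Polynomial.X - Polynomial.C ((b - ‖x‖ : ℝ) : ℂ)) *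
      (Polynomial.X - Polynomial.C ((b + ‖x‖ : ℝ) : ℂ)) *
      (Polynomial.X - Polynomial.C ((a - ‖y‖ : ℝ) : ℂ)) *
      (Polynomial.X - Polynomial.C ((a + ‖y‖ : ℝ) : ℂ)) := by
  have hx : (Polynomial.C x * Polynomial.C ((starRingEnd ℂ) x) : Polynomial ℂ)
      = Polynomial.C (‖x‖ : ℂ) ^ 2 := by
    rw [← Polynomial.C_mul, Complex.mul_conj, Complex.normSq_eq_norm_sq]; simp
  have hy : (Polynomial.C y * Polynomial.C ((starRingEnd ℂ) y) : Polynomial ℂ)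
      = Polynomial.C (‖y‖ : ℂ) ^ 2 := by
    rw [← Polynomial.C_mul, Complex.mul_conj, Complex.normSq_eq_norm_sq]; simp
  have e : xState a b x y = Matrix.reindex finProdFinEquiv.symm finProdFinEquiv.symm
      !![(a : ℂ), 0, 0, y; 0, (b : ℂ), x, 0; 0, star x, (b : ℂ), 0; star y, 0, 0, (a : ℂ)] := rfl
  rw [e, Matrix.charpoly_reindex, Matrix.charpoly, Matrix.det_succ_row_zero]
  simp [Fin.sum_univ_succ, Matrix.det_fin_three, Matrix.charmatrix_apply, Matrix.submatrix_apply,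
    Fin.succAbove]
  linear_combination (Polynomial.C y * Polynomial.C ((starRingEnd ℂ) y) -
    (Polynomial.X - Polynomial.C (a : ℂ)) ^ 2) * hx +
    (Polynomial.C (‖x‖ : ℂ) ^ 2 - (Polynomial.X - Polynomial.C (b : ℂ)) ^ 2) * hy

end XState

/-! ### Conjugating a local observable on `A` by the X-shaped root. -/

section Conjugation

/-- The off-diagonal entry of the part on `A` of `S (bloch ζ z ⊗ 1) S`, with
`S = xState c d p q`. -/
def transZetaA (c d : ℝ) (p q ζ : ℂ) : ℂ := c * d * ζ + p * q * star ζ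

/-- The off-diagonal entry of the part on `B` of `S (bloch ζ z ⊗ 1) S`. -/
def transZetaB (c d : ℝ) (p q ζ : ℂ) : ℂ := c * star p * ζ + d * q * star ζ

/-- The point is the shape of the right side: no correlation term `σᵢ ⊗ σⱼ` survives, so the
spectral decomposition is explicit. -/
theorem xState_conj (c d : ℝ) (p q ζ : ℂ) (z : ℝ) :
    xState c d p q * (bloch ζ z ⊗ₖ (1 : Op1)) * xState c d p q =
      bloch (transZetaA c d p q ζ)
          (z / 2 * (c ^ 2 - Complex.normSq q + (d ^ 2 - Complex.normSq p))) ⊗ₖ (1 : Op1) +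
        (1 : Op1) ⊗ₖ bloch (transZetaB c d p q ζ)
          (z / 2 * (c ^ 2 - Complex.normSq q - (d ^ 2 - Complex.normSq p))) := by
  have hp := Complex.mul_conj p
  have hq := Complex.mul_conj q
  ext ⟨i, j⟩ ⟨k, l⟩
  fin_cases i <;> fin_cases j <;> fin_cases k <;> fin_cases l <;>
    simp [xState_entries, Matrix.mul_apply, Fintype.sum_prod_type, Fin.sum_univ_two, ← hp,
      ← hq, bloch, transZetaA, transZetaB, Matrix.kroneckerMap_apply, Matrix.one_apply] <;> ring

end Conjugation

/-! ### Structure of `A`-classical states and product measurements. -/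

section Classical

theorem trace_proj (α : QubitBasis) (i : Fin 2) : (proj (α i)).trace = 1 := by
  obtain ⟨ζ, z, -, h0, h1⟩ := exists_hasBloch α
  fin_cases i
  · simp [h0, trace_halfPlus]
  · simp [h1, trace_halfPlus]

theorem proj_mul_proj (α : QubitBasis) (i j : Fin 2) :
    proj (α i) * proj (α j) = if i = j then proj (α i) else 0 := by
  obtain ⟨ζ, z, h, h0, h1⟩ := exists_hasBloch α
  have h' : Complex.normSq (-ζ) + (-z) ^ 2 = 1 := by simpa using h
  fin_cases i <;> fin_cases j
  · simpa [h0] using halfPlus_mul_self h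
  · simpa [h0, h1] using halfPlus_mul_neg h
  · simpa [h0, h1] using halfPlus_mul_neg h'
  · simpa [h1] using halfPlus_mul_self h'

theorem proj_isHermitian (α : QubitBasis) (i : Fin 2) : (proj (α i)).IsHermitian := by
  obtain ⟨ζ, z, h, h0, h1⟩ := exists_hasBloch α
  fin_cases i
  · simpa [h0] using halfPlus_isHermitian ζ z
  · simpa [h1] using halfPlus_isHermitian (-ζ) (-z)

/-- Compressing a positive operator by `|v⟩⟨v| ⊗ 1` gives `|v⟩⟨v| ⊗ τ` with `τ` positive. -/
theorem exists_compression (v : EuclideanSpace ℂ (Fin 2)) {X : Op2} (hX : X.PosSemidef) :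
    ∃ τ : Op1, τ.PosSemidef ∧
      (proj v ⊗ₖ (1 : Op1)) * X * (proj v ⊗ₖ (1 : Op1)) = proj v ⊗ₖ τ := by
  -- `B` is `|v⟩ ⊗ 1` as a map from `ℂ²_B` to the two-qubit space.
  let B : Matrix (Fin 2 × Fin 2) (Fin 2) ℂ := Matrix.of fun i k => if i.2 = k then v i.1 else 0
  have hB : ∀ Z : Op1, B * Z * Bᴴ = proj v ⊗ₖ Z := by
    intro Z
    ext ⟨i, j⟩ ⟨k, l⟩
    simp only [B, Matrix.mul_apply, Matrix.of_apply, Matrix.conjTranspose_apply,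
      Matrix.kroneckerMap_apply, proj, Matrix.vecMulVec_apply, Fin.sum_univ_two]
    fin_cases j <;> fin_cases l <;> simp <;> ring
  refine ⟨Bᴴ * X * B, hX.conjTranspose_mul_mul_same B, ?_⟩
  rw [← hB, ← hB]
  simp only [Matrix.mul_one, Matrix.mul_assoc]

theorem isAClassicalIn_of_blocks {α : QubitBasis} {X : Fin 2 → Op2} (hX : ∀ i, (X i).PosSemidef)
    {σ : Op2} (hσ : σ = ∑ i, (proj (α i) ⊗ₖ (1 : Op1)) * X i * (proj (α i) ⊗ₖ (1 : Op1)))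
    (htr : σ.trace = 1) : IsAClassicalIn α σ := by
  choose τ hτ hτX using fun i => exists_compression (α i) (hX i)
  have htr0 : ∀ i, 0 ≤ (τ i).trace := fun i => (hτ i).trace_nonneg
  have hre : ∀ i, (((τ i).trace.re : ℝ) : ℂ) = (τ i).trace := fun i =>
    (Complex.eq_re_of_ofReal_le (r := 0) (by simpa using htr0 i)).symm
  have hσ' : σ = ∑ i, proj (α i) ⊗ₖ τ i := by
    rw [hσ]; exact Finset.sum_congr rfl fun i _ => hτX i
  -- A block of trace zero has weight zero, so its normalised state is arbitrary; the maximally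
  -- mixed one is chosen.
  refine ⟨fun i => (τ i).trace.re, fun i => if (τ i).trace = 0 then (1 / 2 : ℂ) • (1 : Op1)
    else ((τ i).trace)⁻¹ • τ i, fun i => (Complex.le_def.1 (htr0 i)).1, ?_, ?_, ?_⟩
  · rw [hσ', Matrix.trace_sum] at htr
    simp only [Matrix.trace_kronecker, trace_proj, one_mul] at htr
    have := congrArg Complex.re htr
    simpa using this
  · intro i
    by_cases h : (τ i).trace = 0
    · simp only [h, if_true]
      refine ⟨Matrix.PosSemidef.one.smul ?_, by simp⟩
      rw [Complex.le_def]; norm_num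
    · simp only [h, if_false]
      exact ⟨(hτ i).smul (inv_nonneg.2 (htr0 i)), by
        rw [Matrix.trace_smul, smul_eq_mul, inv_mul_cancel₀ h]⟩
  · rw [hσ']
    refine Finset.sum_congr rfl fun i _ => ?_
    rw [hre]
    by_cases h : (τ i).trace = 0
    · have h0 : τ i = 0 := (hτ i).trace_eq_zero_iff.1 h
      simp [h0]
    · simp only [h, if_false]
      rw [Matrix.kronecker_smul, smul_smul, mul_inv_cancel₀ h, one_smul]

/-- A classical state is `G Gᴴ` with `G` commuting with the projectors of the basis. -/
theorem IsAClassicalIn.exists_root {α : QubitBasis} {σ : Op2} (h : IsAClassicalIn α σ) :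
    ∃ G : Op2, G * Gᴴ = σ ∧ σ.trace = 1 ∧
      ∀ i, (proj (α i) ⊗ₖ (1 : Op1)) * G = G * (proj (α i) ⊗ₖ (1 : Op1)) := by
  obtain ⟨w, τ, hw, hsum, hτ, rfl⟩ := h
  refine ⟨∑ i, ((√(w i) : ℝ) : ℂ) • (proj (α i) ⊗ₖ CFC.sqrt (τ i)), ?_, ?_, ?_⟩
  · have hsq : ∀ i, (CFC.sqrt (τ i))ᴴ = CFC.sqrt (τ i) := fun i =>
      (posSemidef_sqrt (τ i)).isHermitian
    simp only [Fin.sum_univ_two, Matrix.conjTranspose_add, Matrix.conjTranspose_smul,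
      Matrix.conjTranspose_kronecker, hsq, (proj_isHermitian α _).eq, Matrix.add_mul,
      Matrix.mul_add, Matrix.smul_mul, Matrix.mul_smul, ← Matrix.mul_kronecker_mul, proj_mul_proj,
      Complex.star_def, Complex.conj_ofReal, sqrt_mul_sqrt (hτ _).1]
    simp [smul_smul, Real.mul_self_sqrt (hw _)]
  · simp only [Matrix.trace_sum, Matrix.trace_smul, Matrix.trace_kronecker, trace_proj, (hτ _).2]
    simp only [mul_one, smul_eq_mul]
    exact_mod_cast hsum
  · intro i
    rw [Matrix.mul_sum, Matrix.sum_mul]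
    refine Finset.sum_congr rfl fun j _ => ?_
    rw [Matrix.mul_smul, Matrix.smul_mul, ← Matrix.mul_kronecker_mul, ← Matrix.mul_kronecker_mul,
      proj_mul_proj, proj_mul_proj, Matrix.one_mul, Matrix.mul_one]
    by_cases hij : i = j
    · subst hij; rfl
    · rw [if_neg hij, if_neg (Ne.symm hij)]

theorem rank_eq_of_idempotent {P : Op2} (hP : P * P = P) {k : ℕ} (h : P.trace = k) :
    P.rank = k := by
  have hid : IsIdempotentElem (Matrix.toLin' P) := by
    rw [IsIdempotentElem, Module.End.mul_eq_comp, ← Matrix.toLin'_mul, hP]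
  have := (LinearMap.IsIdempotentElem.isProj_range _ hid).trace
  rw [Matrix.trace_toLin'_eq, h] at this
  rw [Matrix.rank, ← Matrix.toLin'_apply']
  exact_mod_cast this.symm

theorem isVonNeumann_halfPlus {ζ : ℂ} {z : ℝ} (h : Complex.normSq ζ + z ^ 2 = 1) :
    IsVonNeumann ![halfPlus ζ z ⊗ₖ (1 : Op1), halfPlus (-ζ) (-z) ⊗ₖ (1 : Op1)] := by
  have key : ∀ {ζ : ℂ} {z : ℝ}, Complex.normSq ζ + z ^ 2 = 1 →
      (halfPlus ζ z ⊗ₖ (1 : Op1)).IsHermitian ∧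
      (halfPlus ζ z ⊗ₖ (1 : Op1)) * (halfPlus ζ z ⊗ₖ (1 : Op1)) = halfPlus ζ z ⊗ₖ (1 : Op1) ∧
      (halfPlus ζ z ⊗ₖ (1 : Op1)).rank = 2 := by
    intro ζ z h
    have hid : (halfPlus ζ z ⊗ₖ (1 : Op1)) * (halfPlus ζ z ⊗ₖ (1 : Op1))
        = halfPlus ζ z ⊗ₖ (1 : Op1) := by
      rw [← Matrix.mul_kronecker_mul, halfPlus_mul_self h, Matrix.mul_one]
    refine ⟨?_, hid, rank_eq_of_idempotent hid ?_⟩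
    · rw [Matrix.IsHermitian, Matrix.conjTranspose_kronecker, (halfPlus_isHermitian ζ z).eq,
        Matrix.conjTranspose_one]
    · rw [Matrix.trace_kronecker, trace_halfPlus]
      simp
  have h' : Complex.normSq (-ζ) + (-z) ^ 2 = 1 := by simpa using h
  have hm : halfPlus (-ζ) (-z) * halfPlus ζ z = 0 := by simpa using halfPlus_mul_neg h'
  refine ⟨?_, ?_, ?_⟩
  · intro i
    fin_cases i
    · exact key h
    · exact key h'
  · intro i j hij
    fin_cases i <;> fin_cases j
    · exact absurd rfl hij
    · simp [← Matrix.mul_kronecker_mul, halfPlus_mul_neg h]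
    · simp [← Matrix.mul_kronecker_mul, hm]
    · exact absurd rfl hij
  · simp [Fin.sum_univ_two, ← Matrix.add_kronecker, halfPlus_add_neg]

end Classical

/-! ### Optimal discrimination in a fixed basis: primal and dual solutions. -/

section Discrimination

/-- The normalised X-state with square root `xState c d p q`. -/
def squaredX (c d : ℝ) (p q : ℂ) : Op2 :=
  xState (c ^ 2 + Complex.normSq q) (d ^ 2 + Complex.normSq p) (2 * d * p) (2 * c * q)

/-- `xState c d p q` is the square root of a density matrix. -/
structure IsRoot (c d : ℝ) (p q : ℂ) : Prop where
  norm_p_le : ‖p‖ ≤ d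
  norm_q_le : ‖q‖ ≤ c
  sum_eq : c ^ 2 + Complex.normSq q + (d ^ 2 + Complex.normSq p) = 1 / 2

/-- The length of the Bloch vector on `A` of `S (bloch ζ z ⊗ 1) S`. -/
noncomputable def gain (c d : ℝ) (p q ζ : ℂ) (z : ℝ) : ℝ :=
  √(Complex.normSq (transZetaA c d p q ζ) +
    (z / 2 * (c ^ 2 - Complex.normSq q + (d ^ 2 - Complex.normSq p))) ^ 2)

variable {c d : ℝ} {p q : ℂ}

theorem IsRoot.normSq_p_le (h : IsRoot c d p q) : Complex.normSq p ≤ d ^ 2 := by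
  rw [Complex.normSq_eq_norm_sq]
  exact pow_le_pow_left₀ (norm_nonneg _) h.norm_p_le 2

theorem IsRoot.normSq_q_le (h : IsRoot c d p q) : Complex.normSq q ≤ c ^ 2 := by
  rw [Complex.normSq_eq_norm_sq]
  exact pow_le_pow_left₀ (norm_nonneg _) h.norm_q_le 2

/-- With the matching `z` terms added, the squared length on `A` exceeds that on `B` by `(c² -
|q|²)(d² - |p|²)` for a unit Bloch vector. This is nonnegative when `S` is, so the vector on `B` is
never the longer one. -/
theorem normSq_transZetaA_sub (c d : ℝ) (p q ζ : ℂ) :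
    Complex.normSq (transZetaA c d p q ζ) - Complex.normSq (transZetaB c d p q ζ) =
      Complex.normSq ζ * ((c ^ 2 - Complex.normSq q) * (d ^ 2 - Complex.normSq p)) := by
  simp only [transZetaA, transZetaB, Complex.normSq_apply]
  simp
  ring

/-- Factoring the length of the `A`-vector out of `xState_conj` leaves a unit vector on `A` and a
vector of the unit ball on `B`. The signs of the eigenvalues are then governed by `A` alone. -/
theorem IsRoot.exists_direction (h : IsRoot c d p q) {ζ : ℂ} {z : ℝ}
    (hu : Complex.normSq ζ + z ^ 2 = 1) :
    ∃ ζh zh ζw zw, Complex.normSq ζh + zh ^ 2 = 1 ∧ Complex.normSq ζw + zw ^ 2 ≤ 1 ∧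
      transZetaA c d p q ζ = gain c d p q ζ z * ζh ∧
      transZetaB c d p q ζ = gain c d p q ζ z * ζw ∧
      xState c d p q * (bloch ζ z ⊗ₖ (1 : Op1)) * xState c d p q =
        (gain c d p q ζ z : ℂ) • (bloch ζh zh ⊗ₖ (1 : Op1) + (1 : Op1) ⊗ₖ bloch ζw zw) ∧
      (gain c d p q ζ z = 0 → ζh = ζ) := by
  set v := gain c d p q ζ z with hv
  set A := c ^ 2 - Complex.normSq q with hA
  set B := d ^ 2 - Complex.normSq p with hB
  have hA0 : 0 ≤ A := sub_nonneg.2 h.normSq_q_le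
  have hB0 : 0 ≤ B := sub_nonneg.2 h.normSq_p_le
  have hAB : 0 ≤ A * B := mul_nonneg hA0 hB0
  have hv0 : 0 ≤ v := Real.sqrt_nonneg _
  have hvv : v * v = Complex.normSq (transZetaA c d p q ζ) + (z / 2 * (A + B)) ^ 2 :=
    Real.mul_self_sqrt (add_nonneg (Complex.normSq_nonneg _) (sq_nonneg _))
  have hw : Complex.normSq (transZetaB c d p q ζ) + (z / 2 * (A - B)) ^ 2 ≤ v * v := by
    have := normSq_transZetaA_sub c d p q ζ
    rw [← hA, ← hB] at this
    rw [hvv]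
    nlinarith [mul_nonneg (Complex.normSq_nonneg ζ) hAB, mul_nonneg (sq_nonneg z) hAB]
  have hconj := xState_conj c d p q ζ z
  rw [← hA, ← hB] at hconj
  rcases eq_or_ne v 0 with h0 | h0
  · have hA1 : transZetaA c d p q ζ = 0 := by
      refine Complex.normSq_eq_zero.1 (le_antisymm ?_ (Complex.normSq_nonneg _))
      nlinarith [sq_nonneg (z / 2 * (A + B))]
    have hA2 : z / 2 * (A + B) = 0 := by
      rw [hA1, h0] at hvv
      simpa using hvv.symm
    have hB1 : transZetaB c d p q ζ = 0 := by
      refine Complex.normSq_eq_zero.1 (le_antisymm ?_ (Complex.normSq_nonneg _))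
      nlinarith [sq_nonneg (z / 2 * (A - B))]
    have hB2 : z / 2 * (A - B) = 0 := by
      rw [hB1, h0] at hw
      refine pow_eq_zero_iff (two_ne_zero) |>.1 (le_antisymm ?_ (sq_nonneg _))
      simpa using hw
    -- When the gain vanishes any unit direction would do. Keeping that of the basis makes the
    -- direction parallel to `ζ` here too, as `IsRoot.exists_correlated` requires.
    refine ⟨ζ, z, 0, 0, hu, by simp, by simp [h0, hA1], by simp [h0, hB1], ?_, fun _ => rfl⟩
    rw [hconj, hA1, hA2, hB1, hB2, h0]
    have : bloch 0 0 = 0 := by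
      ext i j
      fin_cases i <;> fin_cases j <;> simp [bloch]
    simp [this]
  · have hvc : (v : ℂ) ≠ 0 := by exact_mod_cast h0
    have e1 : transZetaA c d p q ζ = v * (transZetaA c d p q ζ / v) := by field_simp
    have e2 : transZetaB c d p q ζ = v * (transZetaB c d p q ζ / v) := by field_simp
    have e3 : z / 2 * (A + B) = v * (z / 2 * (A + B) / v) := by field_simp
    have e4 : z / 2 * (A - B) = v * (z / 2 * (A - B) / v) := by field_simp
    refine ⟨transZetaA c d p q ζ / v, z / 2 * (A + B) / v, transZetaB c d p q ζ / v,
      z / 2 * (A - B) / v, ?_, ?_, e1, e2, ?_, fun h => absurd h h0⟩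
    · rw [Complex.normSq_div, Complex.normSq_ofReal, div_pow, ← sq, ← add_div, div_eq_one_iff_eq]
      · rw [sq v, hvv]
      · positivity
    · rw [Complex.normSq_div, Complex.normSq_ofReal, div_pow, ← sq, ← add_div, div_le_one]
      · rw [sq v]; exact hw
      · positivity
    · rw [hconj]
      nth_rewrite 1 [e1, e2, e3, e4]
      rw [bloch_smul, bloch_smul, Matrix.smul_kronecker, Matrix.kronecker_smul, smul_add]

theorem squaredX_eq (c d : ℝ) (p q : ℂ) : xState c d p q * xState c d p q = squaredX c d p q :=
  xState_mul_self c d p q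

theorem IsRoot.sqrt_eq (h : IsRoot c d p q) : CFC.sqrt (squaredX c d p q) = xState c d p q :=
  sqrt_xState h.norm_p_le h.norm_q_le

theorem IsRoot.trace_eq_one (h : IsRoot c d p q) : (squaredX c d p q).trace = 1 := by
  have := h.sum_eq
  rw [squaredX, trace_xState]
  have h2 : 2 * (c ^ 2 + Complex.normSq q + (d ^ 2 + Complex.normSq p)) = 1 := by linarith
  exact_mod_cast h2

/-- The two diagonal entries of `ρ_A` are both `a + b = 1/2` and its off-diagonal entries vanish, so
every basis sees the same weights. -/
theorem IsRoot.weight_eq (h : IsRoot c d p q) (α : QubitBasis) (i : Fin 2) :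
    weight (squaredX c d p q) α i = 1 / 2 := by
  have hr : reducedA (squaredX c d p q) = (1 / 2 : ℂ) • (1 : Op1) := by
    have h2 : ((c ^ 2 + Complex.normSq q + (d ^ 2 + Complex.normSq p) : ℝ) : ℂ) = 1 / 2 := by
      rw [h.sum_eq]; norm_num
    push_cast at h2
    ext k l
    fin_cases k <;> fin_cases l <;>
      simp [reducedA, squaredX, xState_entries, Fin.sum_univ_two]
    · linear_combination h2
    · linear_combination h2
  have hn := (orthonormal_iff_ite.1 α.orthonormal) i i
  rw [EuclideanSpace.inner_eq_star_dotProduct, if_pos rfl] at hn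
  have hn' : (fun k => star (α i k)) ⬝ᵥ (fun k => α i k) = 1 := by
    rw [dotProduct_comm]; exact hn
  rw [weight, hr, Matrix.smul_mulVec, Matrix.one_mulVec, dotProduct_smul, hn']
  norm_num

/-- The operator dominating both `S A_i S`. -/
theorem IsRoot.exists_dual (h : IsRoot c d p q) {ζ : ℂ} {z : ℝ}
    (hu : Complex.normSq ζ + z ^ 2 = 1) :
    ∃ Y : Op2, Y.PosSemidef ∧ Y.trace.re = 1 / 2 + 2 * gain c d p q ζ z ∧
      (Y - xState c d p q * (halfPlus ζ z ⊗ₖ (1 : Op1)) * xState c d p q).PosSemidef ∧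
      (Y - xState c d p q * (halfPlus (-ζ) (-z) ⊗ₖ (1 : Op1)) * xState c d p q).PosSemidef := by
  obtain ⟨ζh, zh, ζw, zw, hh, hw, -, -, hconj, -⟩ := h.exists_direction hu
  set S := xState c d p q with hS
  set v := gain c d p q ζ z with hv
  have hv0 : 0 ≤ v := Real.sqrt_nonneg _
  have hv2 : (0 : ℂ) ≤ ((2 * v : ℝ) : ℂ) := by exact_mod_cast (by linarith : (0 : ℝ) ≤ 2 * v)
  have hh' : Complex.normSq (-ζh) + (-zh) ^ 2 = 1 := by simpa using hh
  have hw' : Complex.normSq (-ζw) + (-zw) ^ 2 ≤ 1 := by simpa using hw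
  have hSH : S.IsHermitian := xState_isHermitian c d p q
  have hL1 : (S * (halfPlus (-ζ) (-z) ⊗ₖ (1 : Op1)) * S).PosSemidef := by
    have := ((posSemidef_halfPlus (by simpa using hu.le : Complex.normSq (-ζ) + (-z) ^ 2 ≤ 1)
      ).kronecker (Matrix.PosSemidef.one (n := Fin 2) (R := ℂ))).mul_mul_conjTranspose_same S
    rwa [hSH.eq] at this
  have hplus : (((2 * v : ℝ) : ℂ) • (halfPlus ζh zh ⊗ₖ halfPlus ζw zw)).PosSemidef :=
    ((posSemidef_halfPlus hh.le).kronecker (posSemidef_halfPlus hw)).smul hv2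
  have hminus : (((2 * v : ℝ) : ℂ) • (halfPlus (-ζh) (-zh) ⊗ₖ halfPlus (-ζw) (-zw))).PosSemidef :=
    ((posSemidef_halfPlus hh'.le).kronecker (posSemidef_halfPlus hw')).smul hv2
  have hdiff : S * (halfPlus ζ z ⊗ₖ (1 : Op1)) * S - S * (halfPlus (-ζ) (-z) ⊗ₖ (1 : Op1)) * S =
      (v : ℂ) • (bloch ζh zh ⊗ₖ (1 : Op1) + (1 : Op1) ⊗ₖ bloch ζw zw) := by
    rw [← hconj, ← halfPlus_sub_neg ζ z, sub_eq_add_neg (halfPlus ζ z), Matrix.add_kronecker,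
      Matrix.mul_add, Matrix.add_mul, ← sub_neg_eq_add, ← Matrix.neg_mul, ← Matrix.mul_neg]
    congr 3
    ext ⟨i, j⟩ ⟨k, l⟩
    simp [Matrix.kroneckerMap_apply]
  have hsum : S * (halfPlus ζ z ⊗ₖ (1 : Op1)) * S + S * (halfPlus (-ζ) (-z) ⊗ₖ (1 : Op1)) * S =
      squaredX c d p q := by
    rw [← Matrix.add_mul, ← Matrix.mul_add, ← Matrix.add_kronecker, halfPlus_add_neg,
      Matrix.one_kronecker_one, Matrix.mul_one, squaredX_eq]
  -- This is the Jordan decomposition of the difference; the two terms are orthogonal through their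
  -- factors on `A` and positive because `|w| ≤ 1`.
  have hpm : ((2 * v : ℝ) : ℂ) • (halfPlus ζh zh ⊗ₖ halfPlus ζw zw) -
      ((2 * v : ℝ) : ℂ) • (halfPlus (-ζh) (-zh) ⊗ₖ halfPlus (-ζw) (-zw)) =
      (v : ℂ) • (bloch ζh zh ⊗ₖ (1 : Op1) + (1 : Op1) ⊗ₖ bloch ζw zw) := by
    ext ⟨i, j⟩ ⟨k, l⟩
    simp only [halfPlus, bloch_neg, Matrix.sub_apply, Matrix.smul_apply, Matrix.add_apply,
      Matrix.kroneckerMap_apply, Matrix.neg_apply, smul_eq_mul]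
    push_cast
    ring
  -- `Y` is `S A₁ S` plus the positive part of `S A₀ S - S A₁ S`. Subtracting either operator leaves
  -- the negative or the positive part.
  refine ⟨S * (halfPlus (-ζ) (-z) ⊗ₖ (1 : Op1)) * S +
    ((2 * v : ℝ) : ℂ) • (halfPlus ζh zh ⊗ₖ halfPlus ζw zw), hL1.add hplus, ?_, ?_, ?_⟩
  · have t1 := congrArg Matrix.trace hdiff
    have t2 := congrArg Matrix.trace hsum
    rw [h.trace_eq_one] at t2
    simp only [Matrix.trace_sub, Matrix.trace_add, Matrix.trace_smul, Matrix.trace_kronecker,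
      trace_bloch, zero_mul, mul_zero, add_zero, smul_zero] at t1 t2
    have t3 : (S * (halfPlus (-ζ) (-z) ⊗ₖ (1 : Op1)) * S).trace = 1 / 2 := by
      linear_combination (1 / 2 : ℂ) * t2 - (1 / 2 : ℂ) * t1
    rw [Matrix.trace_add, t3, Matrix.trace_smul, Matrix.trace_kronecker, trace_halfPlus,
      trace_halfPlus]
    simp
  · convert hminus using 1
    rw [← hpm] at hdiff
    rw [eq_comm, ← sub_eq_zero]
    rw [← sub_eq_zero] at hdiff
    rw [← hdiff]
    abel
  · simpa using hplus

/-- Measuring along `h` on `A` alone does not see the `B` term, whose trace against `bloch ζh zh ⊗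
1` is zero, and picks up the full gain from the `A` term. -/
theorem IsRoot.exists_primal (h : IsRoot c d p q) {ζ : ℂ} {z : ℝ}
    {ζh ζw : ℂ} {zh zw : ℝ}
    (hh : Complex.normSq ζh + zh ^ 2 = 1)
    (hconj : xState c d p q * (bloch ζ z ⊗ₖ (1 : Op1)) * xState c d p q =
        (gain c d p q ζ z : ℂ) • (bloch ζh zh ⊗ₖ (1 : Op1) + (1 : Op1) ⊗ₖ bloch ζw zw)) :
    ((halfPlus ζh zh ⊗ₖ (1 : Op1)) *
        (xState c d p q * (halfPlus ζ z ⊗ₖ (1 : Op1)) * xState c d p q)).trace +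
      ((halfPlus (-ζh) (-zh) ⊗ₖ (1 : Op1)) *
        (xState c d p q * (halfPlus (-ζ) (-z) ⊗ₖ (1 : Op1)) * xState c d p q)).trace =
      ((1 / 2 + 2 * gain c d p q ζ z : ℝ) : ℂ) := by
  set S := xState c d p q with hS
  set v := gain c d p q ζ z with hv
  have hL : ∀ ε : ℂ, S * (((1 / 2 : ℂ) • (1 + ε • bloch ζ z)) ⊗ₖ (1 : Op1)) * S =
      (1 / 2 : ℂ) • (squaredX c d p q + ε •
        ((v : ℂ) • (bloch ζh zh ⊗ₖ (1 : Op1) + (1 : Op1) ⊗ₖ bloch ζw zw))) := by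
    intro ε
    rw [← hconj, ← squaredX_eq]
    simp only [Matrix.smul_kronecker, Matrix.add_kronecker, Matrix.one_kronecker_one,
      Matrix.mul_smul, Matrix.smul_mul, Matrix.mul_add, Matrix.add_mul, Matrix.mul_one, hS]
  have hp := hL 1
  have hm := hL (-1)
  simp only [one_smul, neg_smul] at hp hm
  have ep : halfPlus ζ z = (1 / 2 : ℂ) • (1 + bloch ζ z) := rfl
  have em : halfPlus (-ζ) (-z) = (1 / 2 : ℂ) • (1 + -bloch ζ z) := by rw [halfPlus, bloch_neg]
  rw [ep, em, hp, hm, halfPlus, halfPlus, bloch_neg]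
  have tr := h.trace_eq_one
  have hb : (bloch ζh zh * bloch ζh zh).trace = 2 := by
    rw [bloch_mul_self, hh]; simp
  have hneg : ∀ M : Op1, (-M) ⊗ₖ (1 : Op1) = -(M ⊗ₖ (1 : Op1)) := by
    intro M
    ext ⟨i, j⟩ ⟨k, l⟩
    simp [Matrix.kroneckerMap_apply]
  simp only [Matrix.smul_kronecker, Matrix.add_kronecker, Matrix.one_kronecker_one, hneg,
    Matrix.mul_smul, Matrix.smul_mul, Matrix.mul_add, Matrix.add_mul, Matrix.mul_one,
    Matrix.one_mul, Matrix.trace_add, Matrix.trace_smul, Matrix.trace_neg, Matrix.neg_mul,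
    Matrix.mul_neg, ← Matrix.mul_kronecker_mul, Matrix.trace_kronecker, trace_bloch, hb, tr,
    Matrix.trace_one, smul_eq_mul]
  push_cast
  simp
  ring

end Discrimination

/-! ### Maximal fidelity and success probability in a fixed basis. -/

section PerBasis

variable {c d : ℝ} {p q : ℂ}

theorem gain_nonneg (c d : ℝ) (p q ζ : ℂ) (z : ℝ) : 0 ≤ gain c d p q ζ z := Real.sqrt_nonneg _

theorem IsRoot.weight_mul_trace (h : IsRoot c d p q) (α : QubitBasis) (i : Fin 2) (E : Op2) :
    weight (squaredX c d p q) α i * ((E * ensembleState (squaredX c d p q) α i).trace).re =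
      (E * (xState c d p q * (proj (α i) ⊗ₖ (1 : Op1)) * xState c d p q)).trace.re := by
  rw [ensembleState, h.weight_eq, h.sqrt_eq, Matrix.mul_smul, Matrix.trace_smul]
  have : (((1 / 2 : ℝ) : ℂ))⁻¹ = ((2 : ℝ) : ℂ) := by push_cast; norm_num
  rw [this, smul_eq_mul, Complex.re_ofReal_mul]
  ring

/-- Weak duality closes: the product measurement along `h` attains the trace of `Y`. -/
theorem IsRoot.optSuccessProb_eq (h : IsRoot c d p q) {α : QubitBasis} {ζ : ℂ} {z : ℝ}
    (hα : HasBloch α ζ z) :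
    optSuccessProb (squaredX c d p q) α = 1 / 2 + 2 * gain c d p q ζ z := by
  obtain ⟨hu, h0, h1⟩ := hα
  refine IsGreatest.csSup_eq ⟨?_, ?_⟩
  · obtain ⟨ζh, zh, ζw, zw, hh, -, -, -, hconj, -⟩ := h.exists_direction hu
    refine ⟨_, isVonNeumann_halfPlus hh, ?_⟩
    have := congrArg Complex.re (h.exists_primal hh hconj)
    rw [Complex.add_re, Complex.ofReal_re] at this
    simp only [h.weight_mul_trace, Fin.sum_univ_two, Matrix.cons_val_zero, Matrix.cons_val_one,
      h0, h1]
    exact this.symm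
  · rintro r ⟨P, ⟨hP, -, hsum⟩, rfl⟩
    obtain ⟨Y, -, htr, hY0, hY1⟩ := h.exists_dual hu
    rw [Fin.sum_univ_two] at hsum
    simp only [h.weight_mul_trace, Fin.sum_univ_two, h0, h1]
    rw [← htr]
    exact trace_add_trace_le (posSemidef_of_isHermitian_of_mul_self (hP 0).1 (hP 0).2.1)
      (posSemidef_of_isHermitian_of_mul_self (hP 1).1 (hP 1).2.1) hsum hY0 hY1

theorem IsRoot.fidelity_le (h : IsRoot c d p q) {α : QubitBasis} {ζ : ℂ} {z : ℝ}
    (hα : HasBloch α ζ z) {σ : Op2} (hσ : IsAClassicalIn α σ) :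
    fidelity (squaredX c d p q) σ ≤ 1 / 2 + 2 * gain c d p q ζ z := by
  obtain ⟨G, rfl, htr, hG⟩ := hσ.exists_root
  obtain ⟨Y, hY, htrY, hY0, hY1⟩ := h.exists_dual hα.1
  rw [← hα.2.1] at hY0
  rw [← hα.2.2] at hY1
  rw [fidelity, h.sqrt_eq, ← htrY]
  have hH : ∀ i, (proj (α i) ⊗ₖ (1 : Op1)).IsHermitian := fun i => by
    rw [Matrix.IsHermitian, Matrix.conjTranspose_kronecker, (proj_isHermitian α i).eq,
      Matrix.conjTranspose_one]
  refine sq_trace_sqrt_le (xState_isHermitian c d p q) (hH 0) (hH 1) ?_ ?_ ?_ ?_ ?_ htr (hG 0)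
    (hG 1) hY hY0 hY1
  · simp [← Matrix.mul_kronecker_mul, proj_mul_proj]
  · simp [← Matrix.mul_kronecker_mul, proj_mul_proj]
  · simp [← Matrix.mul_kronecker_mul, proj_mul_proj]
  · simp [← Matrix.mul_kronecker_mul, proj_mul_proj]
  · rw [← Matrix.add_kronecker, sum_proj, Matrix.one_kronecker_one]

/-- A classical state attaining the bound, in explicit form. -/
theorem IsRoot.exists_attaining (h : IsRoot c d p q) {α : QubitBasis} {ζ : ℂ} {z : ℝ}
    (hα : HasBloch α ζ z) {ζh ζw : ℂ} {zh zw : ℝ} (hh : Complex.normSq ζh + zh ^ 2 = 1)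
    (hconj : xState c d p q * (bloch ζ z ⊗ₖ (1 : Op1)) * xState c d p q =
        (gain c d p q ζ z : ℂ) • (bloch ζh zh ⊗ₖ (1 : Op1) + (1 : Op1) ⊗ₖ bloch ζw zw)) :
    ∃ σ, IsAClassicalIn α σ ∧ 1 / 2 + 2 * gain c d p q ζ z ≤ fidelity (squaredX c d p q) σ ∧
      ((1 / 2 + 2 * gain c d p q ζ z : ℝ) : ℂ) • σ =
        (halfPlus ζ z ⊗ₖ (1 : Op1)) *
            (xState c d p q * (halfPlus ζh zh ⊗ₖ (1 : Op1)) * xState c d p q) *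
            (halfPlus ζ z ⊗ₖ (1 : Op1)) +
          (halfPlus (-ζ) (-z) ⊗ₖ (1 : Op1)) *
            (xState c d p q * (halfPlus (-ζh) (-zh) ⊗ₖ (1 : Op1)) * xState c d p q) *
            (halfPlus (-ζ) (-z) ⊗ₖ (1 : Op1)) := by
  set S := xState c d p q with hS
  have hSH : Sᴴ = S := xState_isHermitian c d p q
  set F : ℝ := 1 / 2 + 2 * gain c d p q ζ z with hF
  have hF0 : 0 < F := by have := gain_nonneg c d p q ζ z; positivity
  have hprimal := h.exists_primal hh hconj
  rw [← hS, ← hF] at hprimal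
  have hH : ∀ (ζ : ℂ) (z : ℝ), (halfPlus ζ z ⊗ₖ (1 : Op1))ᴴ = halfPlus ζ z ⊗ₖ (1 : Op1) := by
    intro ζ z
    rw [Matrix.conjTranspose_kronecker, (halfPlus_isHermitian ζ z).eq, Matrix.conjTranspose_one]
  have hh' : Complex.normSq (-ζh) + (-zh) ^ 2 = 1 := by simpa using hh
  set A₀ := halfPlus ζ z ⊗ₖ (1 : Op1) with hA₀
  set A₁ := halfPlus (-ζ) (-z) ⊗ₖ (1 : Op1) with hA₁
  set P₀ := halfPlus ζh zh ⊗ₖ (1 : Op1) with hP₀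
  set P₁ := halfPlus (-ζh) (-zh) ⊗ₖ (1 : Op1) with hP₁
  have hA₀H : A₀ᴴ = A₀ := hH _ _
  have hA₁H : A₁ᴴ = A₁ := hH _ _
  have hP₀H : P₀ᴴ = P₀ := hH _ _
  have hP₁H : P₁ᴴ = P₁ := hH _ _
  have hA₀A₀ : A₀ * A₀ = A₀ := by
    rw [hA₀, ← Matrix.mul_kronecker_mul, halfPlus_mul_self hα.1, Matrix.one_mul]
  have hA₁A₁ : A₁ * A₁ = A₁ := by
    rw [hA₁, ← Matrix.mul_kronecker_mul, halfPlus_mul_self (by simpa using hα.1), Matrix.one_mul]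
  have hP₀P₀ : P₀ * P₀ = P₀ := by
    rw [hP₀, ← Matrix.mul_kronecker_mul, halfPlus_mul_self hh, Matrix.one_mul]
  have hP₁P₁ : P₁ * P₁ = P₁ := by
    rw [hP₁, ← Matrix.mul_kronecker_mul, halfPlus_mul_self hh', Matrix.one_mul]
  have hP₀P₁ : P₀ * P₁ = 0 := by
    rw [hP₀, hP₁, ← Matrix.mul_kronecker_mul, halfPlus_mul_neg hh, Matrix.zero_kronecker]
  have hP₁P₀ : P₁ * P₀ = 0 := by
    have := congrArg Matrix.conjTranspose hP₀P₁
    rwa [Matrix.conjTranspose_mul, hP₀H, hP₁H, Matrix.conjTranspose_zero] at this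
  -- This choice makes both `tr (S G₀)` and `tr (G₀ G₀ᴴ)` equal to the success probability `F`.
  -- After normalising by `√F`, the trace against `S` is `√F`, and its square is the required
  -- fidelity.
  set G₀ := A₀ * S * P₀ + A₁ * S * P₁ with hG₀
  have hGG : G₀ * G₀ᴴ = A₀ * (S * P₀ * S) * A₀ + A₁ * (S * P₁ * S) * A₁ := by
    have e : G₀ᴴ = P₀ * (S * A₀) + P₁ * (S * A₁) := by
      rw [hG₀]
      simp only [Matrix.conjTranspose_add, Matrix.conjTranspose_mul, hA₀H, hA₁H, hP₀H, hP₁H, hSH]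
    have e2 : G₀ * (P₀ * (S * A₀) + P₁ * (S * A₁)) =
        A₀ * S * (P₀ * P₀) * (S * A₀) + A₀ * S * (P₀ * P₁) * (S * A₁) +
        A₁ * S * (P₁ * P₀) * (S * A₀) + A₁ * S * (P₁ * P₁) * (S * A₁) := by
      rw [hG₀]; noncomm_ring
    rw [e, e2, hP₀P₀, hP₀P₁, hP₁P₀, hP₁P₁]
    simp only [Matrix.mul_zero, Matrix.zero_mul, add_zero, Matrix.mul_assoc]
  have htrblock : ∀ A P : Op2, A * A = A → (A * (S * P * S) * A).trace = (P * (S * A * S)).trace := by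
    intro A P hA
    rw [Matrix.trace_mul_comm, ← Matrix.mul_assoc, hA, Matrix.trace_mul_comm, Matrix.mul_assoc,
      Matrix.mul_assoc, Matrix.trace_mul_comm]
    simp only [Matrix.mul_assoc]
  have htrGG : (G₀ * G₀ᴴ).trace = (F : ℂ) := by
    rw [hGG, Matrix.trace_add, htrblock _ _ hA₀A₀, htrblock _ _ hA₁A₁, hprimal]
  have htrSG : (S * G₀).trace = (F : ℂ) := by
    rw [← hprimal, hG₀, Matrix.mul_add, Matrix.trace_add, Matrix.trace_mul_comm P₀,
      Matrix.trace_mul_comm P₁]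
    simp only [Matrix.mul_assoc]
  have hFc : (F : ℂ) ≠ 0 := by exact_mod_cast hF0.ne'
  have hFpos : (0 : ℂ) ≤ ((F⁻¹ : ℝ) : ℂ) := by exact_mod_cast (inv_pos.2 hF0).le
  set r : ℝ := √(F⁻¹) with hr
  have hrr : r * r = F⁻¹ := Real.mul_self_sqrt (inv_pos.2 hF0).le
  have hr0 : 0 ≤ r := Real.sqrt_nonneg _
  have hσ : ((r : ℂ) • G₀) * ((r : ℂ) • G₀)ᴴ = ((F⁻¹ : ℝ) : ℂ) • (G₀ * G₀ᴴ) := by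
    rw [Matrix.conjTranspose_smul, Matrix.smul_mul, Matrix.mul_smul, smul_smul, Complex.star_def,
      Complex.conj_ofReal, ← Complex.ofReal_mul, hrr]
  refine ⟨((F⁻¹ : ℝ) : ℂ) • (G₀ * G₀ᴴ), ?_, ?_, ?_⟩
  · have hX : ∀ P : Op2, P * P = P → Pᴴ = P → (((F⁻¹ : ℝ) : ℂ) • (S * P * S)).PosSemidef := by
      intro P hP hPH
      have := (posSemidef_of_isHermitian_of_mul_self hPH hP).mul_mul_conjTranspose_same S
      rw [hSH] at this
      exact this.smul hFpos
    refine isAClassicalIn_of_blocks (X := ![((F⁻¹ : ℝ) : ℂ) • (S * P₀ * S),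
      ((F⁻¹ : ℝ) : ℂ) • (S * P₁ * S)]) ?_ ?_ ?_
    · intro i
      fin_cases i
      · exact hX P₀ hP₀P₀ hP₀H
      · exact hX P₁ hP₁P₁ hP₁H
    · rw [hGG, Fin.sum_univ_two, hα.2.1, hα.2.2]
      simp only [Matrix.cons_val_zero, Matrix.cons_val_one, smul_add, Matrix.mul_smul,
        Matrix.smul_mul, hA₀, hA₁]
    · rw [Matrix.trace_smul, htrGG, smul_eq_mul]
      push_cast
      exact inv_mul_cancel₀ hFc
  · have hre : (S * ((r : ℂ) • G₀)).trace.re = r * F := by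
      rw [Matrix.mul_smul, Matrix.trace_smul, htrSG, smul_eq_mul, ← Complex.ofReal_mul,
        Complex.ofReal_re]
    have := sq_le_sq_trace_sqrt (S := S) (G := (r : ℂ) • G₀) hSH
      (by rw [hre]; exact mul_nonneg hr0 hF0.le)
    rw [hre, hσ] at this
    rw [fidelity, h.sqrt_eq, ← hS]
    refine le_trans (le_of_eq ?_) this
    have : (r * F) ^ 2 = r * r * F * F := by ring
    rw [this, hrr, inv_mul_cancel₀ hF0.ne', one_mul]
  · rw [smul_smul, ← Complex.ofReal_mul, mul_inv_cancel₀ hF0.ne', Complex.ofReal_one, one_smul, hGG]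

end PerBasis

/-! ### From maximal gain to fidelity, discord, closest states and optimal bases. -/

section Optimization

variable {c d : ℝ} {p q : ℂ}

/-- The real square root truncates at zero, so squaring the distance is harmless only when the
fidelity is at most one. -/
theorem buresDist_sq {ρ σ : Op2} (h : fidelity ρ σ ≤ 1) :
    buresDist ρ σ ^ 2 = 2 * (1 - √(fidelity ρ σ)) := by
  rw [buresDist, Real.sq_sqrt]
  have := Real.sqrt_le_one.2 h
  linarith

theorem fidelity_nonneg (ρ σ : Op2) : 0 ≤ fidelity ρ σ := sq_nonneg _

/-- `m` is the maximum of the gain over the Bloch sphere. -/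
structure IsMaxGain (c d : ℝ) (p q : ℂ) (m : ℝ) : Prop where
  gain_le : ∀ (ζ : ℂ) (z : ℝ), Complex.normSq ζ + z ^ 2 = 1 → gain c d p q ζ z ≤ m
  exists_eq : ∃ (ζ : ℂ) (z : ℝ), Complex.normSq ζ + z ^ 2 = 1 ∧ gain c d p q ζ z = m
  le_quarter : m ≤ 1 / 4

variable {m : ℝ}

theorem IsRoot.exists_classical (h : IsRoot c d p q) {α : QubitBasis} {ζ : ℂ} {z : ℝ}
    (hα : HasBloch α ζ z) : ∃ σ, IsAClassicalIn α σ ∧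
      fidelity (squaredX c d p q) σ = 1 / 2 + 2 * gain c d p q ζ z := by
  obtain ⟨ζh, zh, ζw, zw, hh, -, -, -, hconj, -⟩ := h.exists_direction hα.1
  obtain ⟨σ, hσ, hle, -⟩ := h.exists_attaining hα hh hconj
  exact ⟨σ, hσ, le_antisymm (h.fidelity_le hα hσ) hle⟩

theorem IsRoot.fidelity_le_max (h : IsRoot c d p q) (hm : IsMaxGain c d p q m) {σ : Op2}
    (hσ : σ ∈ aClassicalStates) : fidelity (squaredX c d p q) σ ≤ 1 / 2 + 2 * m := by
  obtain ⟨α, hα⟩ := hσ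
  obtain ⟨ζ, z, hb⟩ := exists_hasBloch α
  linarith [h.fidelity_le hb hα, hm.gain_le ζ z hb.1]

theorem IsRoot.exists_classical_max (h : IsRoot c d p q) (hm : IsMaxGain c d p q m) :
    ∃ σ ∈ aClassicalStates, fidelity (squaredX c d p q) σ = 1 / 2 + 2 * m := by
  obtain ⟨ζ, z, hu, rfl⟩ := hm.exists_eq
  obtain ⟨α, hα⟩ := exists_basis_hasBloch hu
  obtain ⟨σ, hσ, hF⟩ := h.exists_classical hα
  exact ⟨σ, ⟨α, hσ⟩, hF⟩

theorem IsRoot.isGreatest_fidelity (h : IsRoot c d p q) (hm : IsMaxGain c d p q m) :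
    IsGreatest (fidelity (squaredX c d p q) '' aClassicalStates) (1 / 2 + 2 * m) := by
  obtain ⟨σ, hσ, hF⟩ := h.exists_classical_max hm
  refine ⟨⟨σ, hσ, hF⟩, ?_⟩
  rintro _ ⟨τ, hτ, rfl⟩
  exact h.fidelity_le_max hm hτ

theorem IsRoot.isGreatest_optSuccessProb (h : IsRoot c d p q) (hm : IsMaxGain c d p q m) :
    IsGreatest (Set.range (optSuccessProb (squaredX c d p q))) (1 / 2 + 2 * m) := by
  obtain ⟨ζ, z, hu, hg⟩ := hm.exists_eq
  obtain ⟨α, hα⟩ := exists_basis_hasBloch hu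
  refine ⟨⟨α, by rw [h.optSuccessProb_eq hα, hg]⟩, ?_⟩
  rintro _ ⟨β, rfl⟩
  obtain ⟨ζ', z', hb⟩ := exists_hasBloch β
  linarith [h.optSuccessProb_eq hb, hm.gain_le ζ' z' hb.1]

theorem IsRoot.buresDist_sq_eq (h : IsRoot c d p q) (hm : IsMaxGain c d p q m) {σ : Op2}
    (hσ : σ ∈ aClassicalStates) : buresDist (squaredX c d p q) σ ^ 2 =
      2 * (1 - √(fidelity (squaredX c d p q) σ)) :=
  buresDist_sq (by linarith [h.fidelity_le_max hm hσ, hm.le_quarter])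

theorem IsRoot.isLeast_buresDist (h : IsRoot c d p q) (hm : IsMaxGain c d p q m) :
    IsLeast ((fun σ => buresDist (squaredX c d p q) σ ^ 2) '' aClassicalStates)
      (2 * (1 - √(1 / 2 + 2 * m))) := by
  obtain ⟨σ, hσ, hF⟩ := h.exists_classical_max hm
  refine ⟨⟨σ, hσ, by simp only [h.buresDist_sq_eq hm hσ, hF]⟩, ?_⟩
  rintro _ ⟨τ, hτ, rfl⟩
  simp only [h.buresDist_sq_eq hm hτ]
  linarith [Real.sqrt_le_sqrt (h.fidelity_le_max hm hτ)]

theorem IsRoot.mem_closestStates_iff (h : IsRoot c d p q) (hm : IsMaxGain c d p q m) {σ : Op2} :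
    σ ∈ closestStates (squaredX c d p q) ↔
      σ ∈ aClassicalStates ∧ fidelity (squaredX c d p q) σ = 1 / 2 + 2 * m := by
  refine and_congr_right fun hσ => ⟨fun hmin => ?_, fun hF τ hτ => ?_⟩
  · obtain ⟨τ, hτ, hF⟩ := h.exists_classical_max hm
    have : buresDist (squaredX c d p q) σ ^ 2 ≤ buresDist (squaredX c d p q) τ ^ 2 :=
      pow_le_pow_left₀ (Real.sqrt_nonneg _) (hmin τ hτ) 2
    rw [h.buresDist_sq_eq hm hτ, h.buresDist_sq_eq hm hσ] at this
    have h2 := (Real.sqrt_le_sqrt_iff (fidelity_nonneg (squaredX c d p q) σ)).1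
      (by linarith : √(fidelity (squaredX c d p q) τ) ≤ √(fidelity (squaredX c d p q) σ))
    exact le_antisymm (h.fidelity_le_max hm hσ) (hF ▸ h2)
  · refine Real.sqrt_le_sqrt ?_
    have := Real.sqrt_le_sqrt (h.fidelity_le_max hm hτ)
    rw [hF]
    linarith

theorem IsRoot.isOptimalBasis_iff (h : IsRoot c d p q) (hm : IsMaxGain c d p q m)
    {α : QubitBasis} {ζ : ℂ} {z : ℝ} (hα : HasBloch α ζ z) :
    IsOptimalBasis (squaredX c d p q) α ↔ gain c d p q ζ z = m := by
  constructor
  · intro ho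
    obtain ⟨ζ', z', hu, hg⟩ := hm.exists_eq
    obtain ⟨β, hβ⟩ := exists_basis_hasBloch hu
    have := ho β
    rw [h.optSuccessProb_eq hα, h.optSuccessProb_eq hβ, hg] at this
    exact le_antisymm (hm.gain_le ζ z hα.1) (by linarith)
  · intro hg β
    obtain ⟨ζ', z', hβ⟩ := exists_hasBloch β
    rw [h.optSuccessProb_eq hα, h.optSuccessProb_eq hβ, hg]
    linarith [hm.gain_le ζ' z' hβ.1]

/-- In each basis the best fidelity and the success probability are the same number `1/2 + 2 gain`,
so both conditions say that the gain is maximal. -/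
theorem IsRoot.isOptimalBasis_iff_closest (h : IsRoot c d p q) (hm : IsMaxGain c d p q m)
    (α : QubitBasis) : IsOptimalBasis (squaredX c d p q) α ↔
      ∃ σ ∈ closestStates (squaredX c d p q), IsAClassicalIn α σ := by
  obtain ⟨ζ, z, hα⟩ := exists_hasBloch α
  rw [h.isOptimalBasis_iff hm hα]
  constructor
  · rintro rfl
    obtain ⟨σ, hσ, hF⟩ := h.exists_classical hα
    exact ⟨σ, (h.mem_closestStates_iff hm).2 ⟨⟨α, hσ⟩, hF⟩, hσ⟩
  · rintro ⟨σ, hσ, hσα⟩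
    have := h.fidelity_le hα hσα
    rw [((h.mem_closestStates_iff hm).1 hσ).2] at this
    exact le_antisymm (hm.gain_le ζ z hα.1) (by linarith)

theorem IsRoot.optimalMeasurements_eq (h : IsRoot c d p q) (hm : IsMaxGain c d p q m) :
    optimalMeasurements (squaredX c d p q) = {M | ∃ (ζ : ℂ) (z : ℝ),
      Complex.normSq ζ + z ^ 2 = 1 ∧ gain c d p q ζ z = m ∧ M = blochPair ζ z} := by
  ext M
  constructor
  · rintro ⟨α, ho, rfl⟩
    obtain ⟨ζ, z, hα⟩ := exists_hasBloch α
    exact ⟨ζ, z, hα.1, (h.isOptimalBasis_iff hm hα).1 ho, hα.basisMeasurement_eq⟩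
  · rintro ⟨ζ, z, hu, hg, rfl⟩
    obtain ⟨α, hα⟩ := exists_basis_hasBloch hu
    exact ⟨α, (h.isOptimalBasis_iff hm hα).2 hg, hα.basisMeasurement_eq.symm⟩

end Optimization

/-! ### Maximising the gain over the Bloch sphere. -/

section GainFormula

variable {c d : ℝ} {p q : ℂ}

/-- The gain along the third axis, doubled. -/
noncomputable def axisGain (c d : ℝ) (p q : ℂ) : ℝ := c ^ 2 + d ^ 2 - ‖p‖ ^ 2 - ‖q‖ ^ 2

/-- The largest gain in the equatorial plane, doubled. -/
noncomputable def planeGain (c d : ℝ) (p q : ℂ) : ℝ := 2 * (c * d + ‖p‖ * ‖q‖)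

/-- The phase of `ζ` is half of the phase of `p q`. -/
def Aligned (p q ζ : ℂ) : Prop := p * q * star ζ ^ 2 = ((‖p‖ * ‖q‖ * Complex.normSq ζ : ℝ) : ℂ)

theorem norm_aligned (p q ζ : ℂ) :
    ‖p * q * star ζ ^ 2‖ = ‖p‖ * ‖q‖ * Complex.normSq ζ := by
  rw [norm_mul, norm_mul, norm_pow, norm_star, Complex.normSq_eq_norm_sq]

theorem re_aligned_le (p q ζ : ℂ) :
    (p * q * star ζ ^ 2).re ≤ ‖p‖ * ‖q‖ * Complex.normSq ζ :=
  (Complex.re_le_norm _).trans (norm_aligned p q ζ).le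

theorem aligned_iff_re (p q ζ : ℂ) :
    Aligned p q ζ ↔ (p * q * star ζ ^ 2).re = ‖p‖ * ‖q‖ * Complex.normSq ζ := by
  constructor
  · intro h
    rw [Aligned] at h
    rw [h, Complex.ofReal_re]
  · intro h
    have h2 := Complex.sq_norm (p * q * star ζ ^ 2)
    rw [norm_aligned, Complex.normSq_apply (p * q * star ζ ^ 2), h] at h2
    have him : (p * q * star ζ ^ 2).im = 0 := by
      have : (p * q * star ζ ^ 2).im * (p * q * star ζ ^ 2).im = 0 := by linarith
      exact mul_self_eq_zero.1 this
    exact Complex.ext (by rw [h, Complex.ofReal_re]) (by rw [him, Complex.ofReal_im])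

theorem four_normSq_transZetaA (c d : ℝ) (p q ζ : ℂ) :
    4 * Complex.normSq (transZetaA c d p q ζ) = planeGain c d p q ^ 2 * Complex.normSq ζ -
      8 * (c * d) * (‖p‖ * ‖q‖ * Complex.normSq ζ - (p * q * star ζ ^ 2).re) := by
  have hp := Complex.sq_norm p
  have hq := Complex.sq_norm q
  have e : planeGain c d p q ^ 2 =
      4 * ((c * d) ^ 2 + 2 * (c * d) * (‖p‖ * ‖q‖) + ‖p‖ ^ 2 * ‖q‖ ^ 2) := by
    unfold planeGain; ring
  rw [e, hp, hq]
  have e2 : Complex.normSq (transZetaA c d p q ζ) = (c * d) ^ 2 * Complex.normSq ζ +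
      Complex.normSq p * Complex.normSq q * Complex.normSq ζ +
      2 * (c * d) * (p * q * star ζ ^ 2).re := by
    simp only [transZetaA, Complex.normSq_apply, pow_two]
    simp
    ring
  rw [e2]
  ring

/-- On the sphere the first two terms interpolate between the squares of the two candidate maxima,
and the last is a nonnegative misalignment penalty. All three cases are read off from here. -/
theorem sq_two_gain (c d : ℝ) (p q ζ : ℂ) (z : ℝ) :
    (2 * gain c d p q ζ z) ^ 2 = planeGain c d p q ^ 2 * Complex.normSq ζ +
      axisGain c d p q ^ 2 * z ^ 2 -
      8 * (c * d) * (‖p‖ * ‖q‖ * Complex.normSq ζ - (p * q * star ζ ^ 2).re) := by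
  rw [mul_pow, gain, Real.sq_sqrt (add_nonneg (Complex.normSq_nonneg _) (sq_nonneg _)), mul_add,
    show (2 : ℝ) ^ 2 = 4 by norm_num, four_normSq_transZetaA, axisGain, Complex.sq_norm,
    Complex.sq_norm]
  ring

theorem IsRoot.c_nonneg (h : IsRoot c d p q) : 0 ≤ c := (norm_nonneg _).trans h.norm_q_le

theorem IsRoot.d_nonneg (h : IsRoot c d p q) : 0 ≤ d := (norm_nonneg _).trans h.norm_p_le

theorem IsRoot.planeGain_nonneg (h : IsRoot c d p q) : 0 ≤ planeGain c d p q := by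
  have := mul_nonneg h.c_nonneg h.d_nonneg
  have := mul_nonneg (norm_nonneg p) (norm_nonneg q)
  unfold planeGain
  linarith

theorem IsRoot.axisGain_nonneg (h : IsRoot c d p q) : 0 ≤ axisGain c d p q := by
  have := h.normSq_p_le
  have := h.normSq_q_le
  rw [axisGain, Complex.sq_norm, Complex.sq_norm]
  linarith

theorem IsRoot.mul_eq_zero_of_cd (h : IsRoot c d p q) (hcd : c * d = 0) : p * q = 0 := by
  rcases mul_eq_zero.1 hcd with h0 | h0
  · have := h.norm_q_le
    rw [h0] at this
    simp [norm_le_zero_iff.1 this]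
  · have := h.norm_p_le
    rw [h0] at this
    simp [norm_le_zero_iff.1 this]

theorem aligned_of_mul_eq_zero (h : p * q = 0) (ζ : ℂ) : Aligned p q ζ := by
  rw [Aligned, h, ← norm_mul, h]
  simp

theorem IsRoot.defect_nonneg (h : IsRoot c d p q) (ζ : ℂ) :
    0 ≤ 8 * (c * d) * (‖p‖ * ‖q‖ * Complex.normSq ζ - (p * q * star ζ ^ 2).re) :=
  mul_nonneg (by have := mul_nonneg h.c_nonneg h.d_nonneg; linarith)
    (sub_nonneg.2 (re_aligned_le p q ζ))

/-- The factor `c * d` may vanish, but positivity of the root then forces `p * q = 0`, and alignment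
holds for every `ζ`. -/
theorem IsRoot.defect_eq_zero_iff (h : IsRoot c d p q) (ζ : ℂ) :
    8 * (c * d) * (‖p‖ * ‖q‖ * Complex.normSq ζ - (p * q * star ζ ^ 2).re) = 0 ↔
      Aligned p q ζ := by
  rw [aligned_iff_re]
  constructor
  · intro h0
    rcases mul_eq_zero.1 h0 with h1 | h1
    · rw [← aligned_iff_re]
      exact aligned_of_mul_eq_zero (h.mul_eq_zero_of_cd (by linarith)) ζ
    · linarith
  · intro h0
    rw [h0, sub_self, mul_zero]

theorem exists_aligned (p q : ℂ) : ∃ ω, Complex.normSq ω = 1 ∧ Aligned p q ω := by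
  refine ⟨Complex.exp ((Complex.arg (p * q) / 2 : ℝ) * Complex.I), ?_, ?_⟩
  · rw [Complex.normSq_eq_norm_sq, Complex.norm_exp_ofReal_mul_I]; norm_num
  · rw [Aligned, Complex.normSq_eq_norm_sq, Complex.norm_exp_ofReal_mul_I, ← norm_mul]
    have e := Complex.norm_mul_exp_arg_mul_I (p * q)
    rw [Complex.star_def, ← Complex.exp_conj, ← Complex.exp_nat_mul]
    nth_rewrite 1 [← e]
    rw [mul_assoc, ← Complex.exp_add]
    have : (Complex.arg (p * q) : ℂ) * Complex.I + ((2 : ℕ) : ℂ) *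
        (starRingEnd ℂ) (((Complex.arg (p * q) / 2 : ℝ) : ℂ) * Complex.I) = 0 := by
      simp [Complex.conj_ofNat]
      ring
    rw [this]
    simp

/-- Follows from `2cd ≤ c² + d²`, `2|p||q| ≤ |p|² + |q|²` and the trace condition; it keeps the
maximal fidelity at most one. -/
theorem IsRoot.gains_le (h : IsRoot c d p q) :
    planeGain c d p q ≤ 1 / 2 ∧ axisGain c d p q ≤ 1 / 2 := by
  have := h.sum_eq
  rw [← Complex.sq_norm, ← Complex.sq_norm] at this
  unfold planeGain axisGain
  constructor <;> nlinarith [sq_nonneg (c - d), sq_nonneg (‖p‖ - ‖q‖), sq_nonneg ‖p‖, sq_nonneg ‖q‖]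

theorem two_gain_eq_iff {m ζ z} (hm : 0 ≤ m) :
    gain c d p q ζ z = m / 2 ↔ (2 * gain c d p q ζ z) ^ 2 = m ^ 2 := by
  rw [sq_eq_sq₀ (by have := gain_nonneg c d p q ζ z; linarith) hm]
  constructor <;> intro h <;> linarith

theorem IsRoot.isMaxGain_of_le (h : IsRoot c d p q) (hle : planeGain c d p q ≤ axisGain c d p q) :
    IsMaxGain c d p q (axisGain c d p q / 2) := by
  have ha := h.axisGain_nonneg
  have hsq := pow_le_pow_left₀ h.planeGain_nonneg hle 2
  refine ⟨fun ζ z hu => ?_, ⟨0, 1, by simp, ?_⟩, by linarith [h.gains_le.2]⟩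
  · have h1 := sq_two_gain c d p q ζ z
    have h2 := h.defect_nonneg ζ
    have h3 : (2 * gain c d p q ζ z) ^ 2 ≤ axisGain c d p q ^ 2 := by
      nlinarith [mul_le_mul_of_nonneg_right hsq (Complex.normSq_nonneg ζ)]
    linarith [le_of_sq_le_sq h3 ha]
  · rw [two_gain_eq_iff ha, sq_two_gain]
    simp

theorem IsRoot.isMaxGain_of_ge (h : IsRoot c d p q) (hle : axisGain c d p q ≤ planeGain c d p q) :
    IsMaxGain c d p q (planeGain c d p q / 2) := by
  have ha := h.planeGain_nonneg
  have hsq := pow_le_pow_left₀ h.axisGain_nonneg hle 2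
  obtain ⟨ω, hω, hal⟩ := exists_aligned p q
  refine ⟨fun ζ z hu => ?_, ⟨ω, 0, by simp [hω], ?_⟩, by linarith [h.gains_le.1]⟩
  · have h1 := sq_two_gain c d p q ζ z
    have h2 := h.defect_nonneg ζ
    have h3 : (2 * gain c d p q ζ z) ^ 2 ≤ planeGain c d p q ^ 2 := by
      nlinarith [mul_le_mul_of_nonneg_right hsq (sq_nonneg z)]
    linarith [le_of_sq_le_sq h3 ha]
  · rw [two_gain_eq_iff ha, sq_two_gain, (h.defect_eq_zero_iff ω).2 hal, hω]
    ring

theorem IsRoot.gain_eq_iff_of_lt (h : IsRoot c d p q)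
    (hlt : planeGain c d p q < axisGain c d p q) {ζ : ℂ} {z : ℝ}
    (hu : Complex.normSq ζ + z ^ 2 = 1) :
    gain c d p q ζ z = axisGain c d p q / 2 ↔ ζ = 0 := by
  have hsq := pow_lt_pow_left₀ hlt h.planeGain_nonneg two_ne_zero
  rw [two_gain_eq_iff h.axisGain_nonneg, sq_two_gain]
  constructor
  · intro h0
    have h2 := h.defect_nonneg ζ
    have h3 : (axisGain c d p q ^ 2 - planeGain c d p q ^ 2) * Complex.normSq ζ ≤ 0 := by
      nlinarith
    exact Complex.normSq_eq_zero.1 (le_antisymm (by nlinarith [Complex.normSq_nonneg ζ])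
      (Complex.normSq_nonneg ζ))
  · rintro rfl
    have : z ^ 2 = 1 := by simpa using hu
    simp [this]

theorem IsRoot.gain_eq_iff_of_gt (h : IsRoot c d p q)
    (hlt : axisGain c d p q < planeGain c d p q) {ζ : ℂ} {z : ℝ}
    (hu : Complex.normSq ζ + z ^ 2 = 1) :
    gain c d p q ζ z = planeGain c d p q / 2 ↔ z = 0 ∧ Aligned p q ζ := by
  have hsq := pow_lt_pow_left₀ hlt h.axisGain_nonneg two_ne_zero
  rw [two_gain_eq_iff h.planeGain_nonneg, sq_two_gain, ← h.defect_eq_zero_iff]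
  have h2 := h.defect_nonneg ζ
  constructor
  · intro h0
    have h3 : (planeGain c d p q ^ 2 - axisGain c d p q ^ 2) * z ^ 2 ≤ 0 := by
      nlinarith
    have hz : z = 0 := pow_eq_zero_iff two_ne_zero |>.1
      (le_antisymm (by nlinarith [sq_nonneg z]) (sq_nonneg z))
    refine ⟨hz, ?_⟩
    rw [hz] at hu h0
    have : Complex.normSq ζ = 1 := by linarith
    rw [this] at h0 ⊢
    linarith
  · rintro ⟨rfl, h0⟩
    have : Complex.normSq ζ = 1 := by linarith
    rw [h0, this]
    ring

theorem IsRoot.gain_eq_iff_of_eq (h : IsRoot c d p q)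
    (heq : axisGain c d p q = planeGain c d p q) {ζ : ℂ} {z : ℝ}
    (hu : Complex.normSq ζ + z ^ 2 = 1) :
    gain c d p q ζ z = planeGain c d p q / 2 ↔ Aligned p q ζ := by
  rw [two_gain_eq_iff h.planeGain_nonneg, sq_two_gain, ← h.defect_eq_zero_iff, heq, ← mul_add, hu]
  constructor <;> intro h0 <;> linarith

end GainFormula

/-! ### Closest states that determine their basis, and infinitude. -/

section Infinite

variable {c d : ℝ} {p q : ℂ}

/-- For fixed `B`, the functional on the `A` side involves only the identity and the Bloch axis of
the basis, so a nonzero `s` reveals that axis. -/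
theorem IsAClassicalIn.exists_trace_eq {α : QubitBasis} {ζ : ℂ} {z : ℝ} (hα : HasBloch α ζ z)
    {σ : Op2} (h : IsAClassicalIn α σ) (B : Op1) :
    ∃ r s : ℂ, ∀ M : Op1, (σ * (M ⊗ₖ B)).trace = r * M.trace + s * (bloch ζ z * M).trace := by
  obtain ⟨w, τ, -, -, -, rfl⟩ := h
  refine ⟨(1 / 2) * ((w 0 : ℂ) * (τ 0 * B).trace + (w 1 : ℂ) * (τ 1 * B).trace),
    (1 / 2) * ((w 0 : ℂ) * (τ 0 * B).trace - (w 1 : ℂ) * (τ 1 * B).trace), fun M => ?_⟩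
  simp only [Fin.sum_univ_two, Matrix.add_mul, Matrix.smul_mul, ← Matrix.mul_kronecker_mul,
    Matrix.trace_add, Matrix.trace_smul, Matrix.trace_kronecker, hα.2.1, hα.2.2, halfPlus,
    bloch_neg, Matrix.one_mul, Matrix.neg_mul, Matrix.trace_neg, smul_eq_mul]
  ring

/-- A state with correlations along the axis of one basis is classical in no other basis. -/
theorem bloch_eq_smul_of_isAClassicalIn {α β : QubitBasis} {ζ ζ' : ℂ} {z z' : ℝ}
    (hα : HasBloch α ζ z) (hβ : HasBloch β ζ' z') {σ : Op2} (h : IsAClassicalIn α σ)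
    (h' : IsAClassicalIn β σ) {B : Op1} (hB : (σ * (bloch ζ z ⊗ₖ B)).trace ≠ 0) :
    ∃ κ : ℂ, bloch ζ z = κ • bloch ζ' z' := by
  obtain ⟨r, s, hrs⟩ := h.exists_trace_eq hα B
  obtain ⟨r', s', hrs'⟩ := h'.exists_trace_eq hβ B
  have hr : r = r' := by
    have h1 := hrs 1
    rw [hrs' 1] at h1
    simp only [Matrix.mul_one, trace_bloch, mul_zero, add_zero, Matrix.trace_one] at h1
    simpa using h1.symm
  have hs : s ≠ 0 := by
    rintro rfl
    rw [hrs, trace_bloch] at hB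
    simp at hB
  have hM : ∀ M : Op1, s * (bloch ζ z * M).trace = s' * (bloch ζ' z' * M).trace := by
    intro M
    have h1 := hrs M
    rw [hrs' M, hr] at h1
    exact (add_left_cancel h1).symm
  refine ⟨s' / s, ?_⟩
  refine Matrix.ext_iff_trace_mul_right.2 fun M => ?_
  rw [Matrix.smul_mul, Matrix.trace_smul, smul_eq_mul, div_mul_eq_mul_div, eq_div_iff hs, mul_comm,
    hM]

theorem transZetaA_of_aligned {ζ : ℂ} (h : Aligned p q ζ) (hζ : ζ ≠ 0) :
    transZetaA c d p q ζ = ((c * d + ‖p‖ * ‖q‖ : ℝ) : ℂ) * ζ := by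
  have hn := Complex.mul_conj ζ
  rw [Aligned, Complex.ofReal_mul, ← hn] at h
  have hc : (starRingEnd ℂ) ζ ≠ 0 := by simpa using hζ
  have : p * q * star ζ = ((‖p‖ * ‖q‖ : ℝ) : ℂ) * ζ := by
    refine mul_right_cancel₀ hc ?_
    rw [Complex.star_def] at h ⊢
    linear_combination h
  rw [transZetaA, this]
  push_cast
  ring

/-- Optimal bases alone do not give distinct closest states, since one state may be classical in
several bases. A nonzero correlation along the axis rules this out. -/
theorem IsRoot.exists_correlated (h : IsRoot c d p q) (hpq : ¬(p = 0 ∧ q = 0)) {α : QubitBasis}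
    {ζ : ℂ} {z : ℝ} (hα : HasBloch α ζ z) (hζ : ζ ≠ 0) (hal : Aligned p q ζ) :
    ∃ σ, IsAClassicalIn α σ ∧ fidelity (squaredX c d p q) σ = 1 / 2 + 2 * gain c d p q ζ z ∧
      ∃ B : Op1, (σ * (bloch ζ z ⊗ₖ B)).trace ≠ 0 := by
  obtain ⟨ζh, zh, ζw, zw, hh, -, hA, -, hconj, h0⟩ := h.exists_direction hα.1
  obtain ⟨σ, hσ, hle, hF⟩ := h.exists_attaining hα hh hconj
  refine ⟨σ, hσ, le_antisymm (h.fidelity_le hα hσ) hle, ?_⟩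
  have hc0 := h.c_nonneg
  have hd0 := h.d_nonneg
  have hcd := mul_nonneg hc0 hd0
  have hpq0 := mul_nonneg (norm_nonneg p) (norm_nonneg q)
  -- the measurement direction is parallel to the basis direction in the plane
  obtain ⟨k, hk0, hk⟩ : ∃ k : ℝ, 0 ≤ k ∧ ζh = k * ζ := by
    rcases eq_or_ne (gain c d p q ζ z) 0 with hv | hv
    · exact ⟨1, zero_le_one, by simp [h0 hv]⟩
    · have hvc : (gain c d p q ζ z : ℂ) ≠ 0 := by exact_mod_cast hv
      refine ⟨(c * d + ‖p‖ * ‖q‖) / gain c d p q ζ z,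
        div_nonneg (by linarith) (gain_nonneg c d p q ζ z), ?_⟩
      rw [transZetaA_of_aligned hal hζ] at hA
      push_cast at hA ⊢
      rw [div_mul_eq_mul_div, hA]
      field_simp
  -- Up to a positive factor, `E` is the planar part of the `B` operator correlated with the axis of
  -- the basis. Testing it against itself gives a multiple of `|E|²`.
  set E : ℂ := star p * ζ * ((d + c * k : ℝ) : ℂ) + q * star ζ * ((c + d * k : ℝ) : ℂ) with hE
  have hE0 : E ≠ 0 := by
    have hn : 0 < Complex.normSq ζ := Complex.normSq_pos.2 hζ
    rcases eq_or_ne p 0 with rfl | hp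
    · have hq : q ≠ 0 := fun hq => hpq ⟨rfl, hq⟩
      have hc : 0 < c := (norm_pos_iff.2 hq).trans_le h.norm_q_le
      have h1 : c + d * k ≠ 0 := by have := mul_nonneg hd0 hk0; positivity
      have h2 : ((c + d * k : ℝ) : ℂ) ≠ 0 := by exact_mod_cast h1
      have h3 : star ζ ≠ 0 := by simpa using hζ
      rw [hE, star_zero, zero_mul, zero_mul, zero_add]
      exact mul_ne_zero (mul_ne_zero hq h3) h2
    · have hd : 0 < d := (norm_pos_iff.2 hp).trans_le h.norm_p_le
      intro hz
      -- Alignment gives the two summands of `E` the same phase, so they cannot cancel.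
      have e : p * star ζ * E = ((Complex.normSq p * Complex.normSq ζ * (d + c * k) +
          ‖p‖ * ‖q‖ * Complex.normSq ζ * (c + d * k) : ℝ) : ℂ) := by
        have hp' := Complex.mul_conj p
        have hn' := Complex.mul_conj ζ
        rw [Aligned, Complex.star_def] at hal
        rw [hE, Complex.star_def]
        push_cast at hal ⊢
        rw [← hn'] at hal
        rw [← hp', ← hn']
        linear_combination (c + d * k : ℂ) * hal
      rw [hz, mul_zero] at e
      have e' : Complex.normSq p * Complex.normSq ζ * (d + c * k) +
          ‖p‖ * ‖q‖ * Complex.normSq ζ * (c + d * k) = 0 := by exact_mod_cast e.symm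
      have h1 : 0 < Complex.normSq p * Complex.normSq ζ * (d + c * k) := by
        have := Complex.normSq_pos.2 hp
        have := mul_nonneg hc0 hk0
        positivity
      have h2 : 0 ≤ ‖p‖ * ‖q‖ * Complex.normSq ζ * (c + d * k) := by
        have := mul_nonneg hd0 hk0
        positivity
      linarith
  refine ⟨bloch E 0, fun hz => ?_⟩
  have hmul := congrArg (fun X => (X * (bloch ζ z ⊗ₖ bloch E 0)).trace) hF
  simp only [Matrix.smul_mul, Matrix.trace_smul, hz, smul_zero, Matrix.add_mul,
    Matrix.trace_add] at hmul
  have hb2 : bloch ζ z * bloch ζ z = 1 := by rw [bloch_mul_self, hα.1]; simp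
  have comp : ∀ (A : Op1) (ε : ℂ) (X : Op2), A * bloch ζ z * A = ε • A →
      ((A ⊗ₖ (1 : Op1)) * X * (A ⊗ₖ (1 : Op1)) * (bloch ζ z ⊗ₖ bloch E 0)).trace =
        ε * (X * (A ⊗ₖ bloch E 0)).trace := by
    intro A ε X hA
    rw [Matrix.mul_assoc, Matrix.mul_assoc, Matrix.trace_mul_comm, Matrix.mul_assoc,
      ← Matrix.mul_kronecker_mul, ← Matrix.mul_kronecker_mul, hA, Matrix.one_mul, Matrix.mul_one,
      Matrix.smul_kronecker, Matrix.mul_smul, Matrix.trace_smul, smul_eq_mul]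
  have c0 : halfPlus ζ z * bloch ζ z * halfPlus ζ z = (1 : ℂ) • halfPlus ζ z := by
    simp only [halfPlus, Matrix.smul_mul, Matrix.mul_smul, Matrix.add_mul, Matrix.mul_add,
      Matrix.one_mul, Matrix.mul_one, hb2]
    module
  have c1 : halfPlus (-ζ) (-z) * bloch ζ z * halfPlus (-ζ) (-z) =
      (-1 : ℂ) • halfPlus (-ζ) (-z) := by
    simp only [halfPlus, bloch_neg, Matrix.smul_mul, Matrix.mul_smul, Matrix.add_mul,
      Matrix.mul_add, Matrix.one_mul, Matrix.mul_one, Matrix.neg_mul, Matrix.mul_neg, hb2]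
    module
  rw [comp _ _ _ c0, comp _ _ _ c1] at hmul
  -- expand both halves in terms of `ρ` and `S (bloch ⊗ 1) S`
  have hneg : ∀ M N : Op1, (-M) ⊗ₖ N = -(M ⊗ₖ N) := by
    intro M N
    ext ⟨i, j⟩ ⟨k, l⟩
    simp [Matrix.kroneckerMap_apply]
  have hexp : (squaredX c d p q * (bloch ζ z ⊗ₖ bloch E 0)).trace +
      (xState c d p q * (bloch ζh zh ⊗ₖ (1 : Op1)) * xState c d p q *
        ((1 : Op1) ⊗ₖ bloch E 0)).trace = 0 := by
    simp only [halfPlus, bloch_neg, Matrix.smul_kronecker, Matrix.add_kronecker, hneg,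
      Matrix.one_kronecker_one, Matrix.mul_smul, Matrix.smul_mul, Matrix.mul_add, Matrix.add_mul,
      Matrix.mul_one, Matrix.mul_neg, Matrix.neg_mul, Matrix.trace_smul, Matrix.trace_add,
      Matrix.trace_neg, smul_eq_mul, squaredX_eq] at hmul
    linear_combination -2 * hmul
  have t1 : (squaredX c d p q * (bloch ζ z ⊗ₖ bloch E 0)).trace =
      2 * (star E * (d * star p * ζ + c * q * star ζ) +
        E * (d * p * star ζ + c * star q * ζ)) := by
    simp [Matrix.trace, Matrix.mul_apply, Fintype.sum_prod_type, Fin.sum_univ_two, squaredX,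
      xState_entries, bloch, Matrix.kroneckerMap_apply, Complex.conj_ofNat]
    ring
  have t2 : (xState c d p q * (bloch ζh zh ⊗ₖ (1 : Op1)) * xState c d p q *
        ((1 : Op1) ⊗ₖ bloch E 0)).trace =
      2 * (star E * transZetaB c d p q ζh + E * star (transZetaB c d p q ζh)) := by
    have tb : ∀ (η : ℂ) (t : ℝ), (bloch η t * bloch E 0).trace = star E * η + E * star η := by
      intro η t
      simp [bloch, Matrix.trace_fin_two]
      ring
    rw [xState_conj, Matrix.add_mul, ← Matrix.mul_kronecker_mul, ← Matrix.mul_kronecker_mul,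
      Matrix.trace_add, Matrix.trace_kronecker, Matrix.trace_kronecker, Matrix.one_mul,
      Matrix.mul_one, trace_bloch, tb, Matrix.one_mul, Matrix.trace_one]
    simp
  have hEE := Complex.mul_conj E
  rw [t1, t2, hk] at hexp
  have hfin : (4 : ℂ) * (E * (starRingEnd ℂ) E) = 0 := by
    have hE' : (starRingEnd ℂ) E = p * star ζ * ((d + c * k : ℝ) : ℂ) +
        star q * ζ * ((c + d * k : ℝ) : ℂ) := by
      rw [hE]; simp
    have hx : star E * E + E * star E = 0 := by
      have e1 : E = (d * star p * ζ + c * q * star ζ) + transZetaB c d p q (k * ζ) := by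
        rw [hE, transZetaB]; simp; ring
      have e2 : star E = (d * p * star ζ + c * star q * ζ) + star (transZetaB c d p q (k * ζ)) := by
        rw [Complex.star_def, hE', transZetaB]; simp; ring
      have e3 := congrArg (fun w => star E * w) e1
      have e4 := congrArg (fun w => E * w) e2
      linear_combination e3 + e4 + (1 / 2 : ℂ) * hexp
    rw [Complex.star_def] at hx
    linear_combination 2 * hx
  rw [hEE] at hfin
  have : Complex.normSq E = 0 := by
    have := (mul_eq_zero.1 hfin).resolve_left (by norm_num)
    exact_mod_cast this
  exact hE0 (Complex.normSq_eq_zero.1 this)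

/-- A family of pairwise non-parallel optimal directions yields infinitely many closest states. -/
theorem IsRoot.infinite_closestStates (h : IsRoot c d p q) {m : ℝ} (hm : IsMaxGain c d p q m)
    (hpq : ¬(p = 0 ∧ q = 0)) {I : Set ℝ} (hI : I.Infinite) (f : ℝ → ℂ) (g : ℝ → ℝ)
    (hu : ∀ t ∈ I, Complex.normSq (f t) + g t ^ 2 = 1) (hf : ∀ t ∈ I, f t ≠ 0)
    (hal : ∀ t ∈ I, Aligned p q (f t)) (hg : ∀ t ∈ I, gain c d p q (f t) (g t) = m)
    (hinj : ∀ t ∈ I, ∀ s ∈ I, ∀ κ : ℂ, bloch (f t) (g t) = κ • bloch (f s) (g s) → t = s) :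
    (closestStates (squaredX c d p q)).Infinite := by
  have hex : ∀ t : ℝ, ∃ σ : Op2, t ∈ I → σ ∈ closestStates (squaredX c d p q) ∧
      ∃ α : QubitBasis, HasBloch α (f t) (g t) ∧ IsAClassicalIn α σ ∧
        ∃ B : Op1, (σ * (bloch (f t) (g t) ⊗ₖ B)).trace ≠ 0 := by
    intro t
    by_cases ht : t ∈ I
    · obtain ⟨α, hα⟩ := exists_basis_hasBloch (hu t ht)
      obtain ⟨σ, hσ, hF, hB⟩ := h.exists_correlated hpq hα (hf t ht) (hal t ht)
      rw [hg t ht] at hF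
      exact ⟨σ, fun _ => ⟨(h.mem_closestStates_iff hm).2 ⟨⟨α, hσ⟩, hF⟩, α, hα, hσ, hB⟩⟩
    · exact ⟨0, fun h => absurd h ht⟩
  choose σ hσ using hex
  refine Set.infinite_of_injOn_mapsTo (f := σ) (s := I) ?_ (fun t ht => (hσ t ht).1) hI
  intro t ht s hs hts
  obtain ⟨-, α, hα, hσα, B, hB⟩ := hσ t ht
  obtain ⟨-, β, hβ, hσβ, -⟩ := hσ s hs
  rw [← hts] at hσβ
  obtain ⟨κ, hκ⟩ := bloch_eq_smul_of_isAClassicalIn hα hβ hσα hσβ hB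
  exact hinj t ht s hs κ hκ

end Infinite

/-! ### Angular parametrisation of the optimal directions. -/

section Directions

theorem ofReal_sub_mul_I_eq (t φ : ℝ) :
    ((t * Real.cos φ : ℝ) : ℂ) - ((-(t * Real.sin φ) : ℝ) : ℂ) * Complex.I =
      t * Complex.exp ((φ : ℝ) * Complex.I) := by
  rw [Complex.exp_mul_I]
  push_cast
  ring

theorem blochMeasurement_spherical (θ φ : ℝ) :
    blochMeasurement ![Real.sin θ * Real.cos φ, -(Real.sin θ * Real.sin φ), Real.cos θ] =
      blochPair (Real.sin θ * Complex.exp ((φ : ℝ) * Complex.I)) (Real.cos θ) := by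
  rw [blochMeasurement_eq, ← ofReal_sub_mul_I_eq]
  rfl

theorem blochMeasurement_equator (φ : ℝ) :
    blochMeasurement ![Real.cos φ, -Real.sin φ, 0] =
      blochPair (Complex.exp ((φ : ℝ) * Complex.I)) 0 := by
  have := ofReal_sub_mul_I_eq 1 φ
  rw [one_mul, one_mul, Complex.ofReal_one, one_mul] at this
  rw [blochMeasurement_eq, ← this]
  rfl

theorem normSq_ofReal_mul_exp (t φ : ℝ) :
    Complex.normSq (t * Complex.exp ((φ : ℝ) * Complex.I)) = t ^ 2 := by
  rw [Complex.normSq_eq_norm_sq, norm_mul, Complex.norm_exp_ofReal_mul_I, Complex.norm_real,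
    mul_one, Real.norm_eq_abs, sq_abs]

/-- Every complex number is a real multiple of some `exp (i φ / 2)`, `0 ≤ φ < 2 π`. -/
theorem exists_halfAngle (ζ : ℂ) : ∃ φ ∈ Set.Ico 0 (2 * Real.pi), ∃ t : ℝ,
    ζ = t * Complex.exp ((φ / 2 : ℝ) * Complex.I) := by
  have e := Complex.norm_mul_exp_arg_mul_I ζ
  have hpi : Complex.exp ((Real.pi : ℂ) * Complex.I) = -1 := Complex.exp_pi_mul_I
  rcases lt_or_ge (Complex.arg ζ) 0 with h | h
  · refine ⟨2 * (Complex.arg ζ + Real.pi), ⟨?_, ?_⟩, -‖ζ‖, ?_⟩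
    · linarith [Complex.neg_pi_lt_arg ζ]
    · linarith
    · rw [show 2 * (Complex.arg ζ + Real.pi) / 2 = Complex.arg ζ + Real.pi by ring]
      push_cast
      rw [add_mul, Complex.exp_add, hpi]
      nth_rewrite 1 [← e]
      ring
  -- The doubled argument must stay below `2π`, so argument `π` becomes angle `0` with a negative
  -- multiplier.
  · rcases (Complex.arg_le_pi ζ).lt_or_eq with h' | h'
    · refine ⟨2 * Complex.arg ζ, ⟨by linarith, by linarith⟩, ‖ζ‖, ?_⟩
      rw [show 2 * Complex.arg ζ / 2 = Complex.arg ζ by ring, e]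
    · refine ⟨0, ⟨le_rfl, by positivity⟩, -‖ζ‖, ?_⟩
      rw [h', hpi] at e
      nth_rewrite 1 [← e]
      simp

/-- Up to a common sign, a point of the unit circle is `(sin θ, cos θ)` with `0 ≤ θ ≤ π`. -/
theorem exists_angle {t z : ℝ} (h : t ^ 2 + z ^ 2 = 1) : ∃ θ ∈ Set.Icc 0 Real.pi,
    (t = Real.sin θ ∧ z = Real.cos θ) ∨ (t = -Real.sin θ ∧ z = -Real.cos θ) := by
  have hz1 : -1 ≤ z := by nlinarith [sq_nonneg t]
  have hz2 : z ≤ 1 := by nlinarith [sq_nonneg t]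
  have ht : √(1 - z ^ 2) = |t| := by
    rw [show 1 - z ^ 2 = t ^ 2 by linarith, Real.sqrt_sq_eq_abs]
  rcases le_total 0 t with h0 | h0
  · refine ⟨Real.arccos z, ⟨Real.arccos_nonneg z, Real.arccos_le_pi z⟩, Or.inl ⟨?_, ?_⟩⟩
    · rw [Real.sin_arccos, ht, abs_of_nonneg h0]
    · rw [Real.cos_arccos hz1 hz2]
  · refine ⟨Real.arccos (-z), ⟨Real.arccos_nonneg _, Real.arccos_le_pi _⟩, Or.inr ⟨?_, ?_⟩⟩
    · rw [Real.sin_arccos, neg_sq, ht, abs_of_nonpos h0, neg_neg]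
    · rw [Real.cos_arccos (by linarith) (by linarith), neg_neg]

theorem blochPair_spherical_of_eq {ζ : ℂ} {z t φ : ℝ}
    (hζ : ζ = t * Complex.exp ((φ : ℝ) * Complex.I)) (hu : Complex.normSq ζ + z ^ 2 = 1) :
    ∃ θ ∈ Set.Icc 0 Real.pi, blochPair ζ z =
      blochMeasurement ![Real.sin θ * Real.cos φ, -(Real.sin θ * Real.sin φ), Real.cos θ] := by
  rw [hζ, normSq_ofReal_mul_exp] at hu
  obtain ⟨θ, hθ, ⟨rfl, rfl⟩ | ⟨rfl, rfl⟩⟩ := exists_angle hu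
  · exact ⟨θ, hθ, by rw [blochMeasurement_spherical, hζ]⟩
  · refine ⟨θ, hθ, ?_⟩
    rw [blochMeasurement_spherical, ← blochPair_neg, hζ, Complex.ofReal_neg, neg_mul, neg_neg,
      neg_neg]

theorem blochPair_equator_of_eq {ζ : ℂ} {t φ : ℝ}
    (hζ : ζ = t * Complex.exp ((φ : ℝ) * Complex.I)) (hu : Complex.normSq ζ = 1) :
    blochPair ζ 0 = blochMeasurement ![Real.cos φ, -Real.sin φ, 0] := by
  rw [blochMeasurement_equator]
  rw [hζ, normSq_ofReal_mul_exp] at hu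
  rcases sq_eq_sq_iff_eq_or_eq_neg.1 (hu.trans (one_pow 2).symm) with rfl | rfl
  · rw [hζ, Complex.ofReal_one, one_mul]
  · rw [hζ, ← blochPair_neg]
    simp

theorem blochPair_axis : blochPair 0 1 = {Matrix.single 0 0 1, Matrix.single 1 1 1} := by
  have h0 : halfPlus 0 1 = Matrix.single 0 0 1 := by
    ext i j
    fin_cases i <;> fin_cases j <;> simp [halfPlus, bloch]
    norm_num
  have h1 : halfPlus (-0) (-1) = Matrix.single 1 1 1 := by
    ext i j
    fin_cases i <;> fin_cases j <;> simp [halfPlus, bloch]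
    norm_num
  rw [blochPair, h0, h1]

theorem aligned_mul_exp {p q : ℂ} {φ : ℝ}
    (h : p * q = ((‖p‖ * ‖q‖ : ℝ) : ℂ) * Complex.exp (φ * Complex.I)) (t : ℝ) :
    Aligned p q (t * Complex.exp ((φ / 2 : ℝ) * Complex.I)) := by
  have e : Complex.exp (φ * Complex.I) *
      (starRingEnd ℂ) (Complex.exp ((φ / 2 : ℝ) * Complex.I)) ^ 2 = 1 := by
    rw [← Complex.exp_conj, ← Complex.exp_nat_mul, ← Complex.exp_add, Complex.exp_eq_one_iff]
    refine ⟨0, ?_⟩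
    simp [Complex.conj_ofNat]
    ring
  rw [Aligned, normSq_ofReal_mul_exp, h, star_mul', mul_pow, Complex.star_def,
    Complex.conj_ofReal]
  push_cast
  push_cast at e
  linear_combination (‖p‖ * ‖q‖ * t ^ 2 : ℂ) * e

theorem Aligned.exists_eq {p q ζ : ℂ} {φ : ℝ} (hpq : p * q ≠ 0)
    (h : p * q = ((‖p‖ * ‖q‖ : ℝ) : ℂ) * Complex.exp (φ * Complex.I)) (hal : Aligned p q ζ) :
    ∃ t : ℝ, ζ = t * Complex.exp ((φ / 2 : ℝ) * Complex.I) := by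
  set w := Complex.exp ((φ / 2 : ℝ) * Complex.I) with hw
  have hww : w * (starRingEnd ℂ) w = 1 := by
    rw [Complex.mul_conj, Complex.normSq_eq_norm_sq, Complex.norm_exp_ofReal_mul_I]; norm_num
  have hexp : Complex.exp (φ * Complex.I) = w ^ 2 := by
    rw [hw, ← Complex.exp_nat_mul]
    congr 1
    push_cast
    ring
  have hr : ((‖p‖ * ‖q‖ : ℝ) : ℂ) ≠ 0 := by
    rw [← norm_mul]
    exact_mod_cast (norm_ne_zero_iff.2 hpq)
  -- the real number `t = ζ * conj w`
  set s := ζ * (starRingEnd ℂ) w with hs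
  have h1 : (starRingEnd ℂ) s ^ 2 = s * (starRingEnd ℂ) s := by
    rw [Aligned, h, hexp, Complex.ofReal_mul _ (Complex.normSq ζ), ← Complex.mul_conj ζ, mul_assoc] at hal
    have := mul_left_cancel₀ hr hal
    rw [hs, map_mul, Complex.conj_conj]
    rw [Complex.star_def] at this
    linear_combination this - ζ * (starRingEnd ℂ) ζ * hww
  have h2 : (starRingEnd ℂ) s = s := by
    rcases eq_or_ne s 0 with h0 | h0
    · rw [h0, map_zero]
    · have h0' : (starRingEnd ℂ) s ≠ 0 := by simpa using h0
      exact mul_right_cancel₀ h0' (by rw [← h1]; ring)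
  refine ⟨s.re, ?_⟩
  rw [Complex.conj_eq_iff_re.1 h2, hs]
  linear_combination -ζ * hww

theorem eq_of_bloch_spherical {ω κ : ℂ} (hω : ω ≠ 0) {t s : ℝ} (ht : t ∈ Set.Ioo 0 Real.pi)
    (hs : s ∈ Set.Ioo 0 Real.pi)
    (h : bloch (Real.sin t * ω) (Real.cos t) = κ • bloch (Real.sin s * ω) (Real.cos s)) :
    t = s := by
  have h0 := congrFun (congrFun h 0) 0
  have h1 := congrFun (congrFun h 0) 1
  simp only [bloch, Matrix.smul_apply, Matrix.of_apply, Matrix.cons_val_zero, Matrix.cons_val_one,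
    Matrix.cons_val', Matrix.cons_val_fin_one, smul_eq_mul] at h0 h1
  have h2 : ((Real.sin t : ℝ) : ℂ) = κ * (Real.sin s : ℝ) :=
    mul_right_cancel₀ hω (by rw [h1]; ring)
  have h3 : ((Real.sin (t - s) : ℝ) : ℂ) = 0 := by
    rw [Real.sin_sub, Complex.ofReal_sub, Complex.ofReal_mul, Complex.ofReal_mul, h2, h0]
    ring
  have h4 : Real.sin (t - s) = 0 := by exact_mod_cast h3
  rw [Real.sin_eq_zero_iff_of_lt_of_lt (by linarith [ht.1, hs.2]) (by linarith [ht.2, hs.1])] at h4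
  linarith

theorem eq_of_bloch_equator {κ : ℂ} {t s : ℝ} (ht : t ∈ Set.Ioo 0 Real.pi)
    (hs : s ∈ Set.Ioo 0 Real.pi) (h : bloch (Complex.exp ((t : ℝ) * Complex.I)) 0 =
      κ • bloch (Complex.exp ((s : ℝ) * Complex.I)) 0) : t = s := by
  have h0 := congrFun (congrFun h 0) 1
  have h1 := congrFun (congrFun h 1) 0
  simp only [bloch, Matrix.smul_apply, Matrix.of_apply, Matrix.cons_val_zero, Matrix.cons_val_one,
    Matrix.cons_val', Matrix.cons_val_fin_one, smul_eq_mul, Complex.star_def,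
    ← Complex.exp_conj, map_mul, Complex.conj_ofReal, Complex.conj_I] at h0 h1
  rw [Complex.exp_mul_I, Complex.exp_mul_I] at h0
  rw [mul_neg, mul_neg, ← neg_mul, ← neg_mul, Complex.exp_mul_I, Complex.exp_mul_I,
    Complex.cos_neg, Complex.sin_neg, Complex.cos_neg, Complex.sin_neg] at h1
  have hc : Complex.cos t = κ * Complex.cos s := by linear_combination (h0 + h1) / 2
  have hsn : Complex.sin t = κ * Complex.sin s := by
    refine mul_right_cancel₀ Complex.I_ne_zero ?_
    linear_combination (h0 - h1) / 2
  have h3 : ((Real.sin (t - s) : ℝ) : ℂ) = 0 := by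
    rw [Complex.ofReal_sin, Complex.ofReal_sub, Complex.sin_sub, hc, hsn]
    ring
  have h4 : Real.sin (t - s) = 0 := by exact_mod_cast h3
  rw [Real.sin_eq_zero_iff_of_lt_of_lt (by linarith [ht.1, hs.2]) (by linarith [ht.2, hs.1])] at h4
  linarith

end Directions

/-! ### Translation between the root parameters and `a, b, x, y`. -/

section Translation

variable {c d : ℝ} {p q : ℂ}

theorem IsRoot.norm_x (h : IsRoot c d p q) : ‖2 * (d : ℂ) * p‖ = 2 * d * ‖p‖ := by
  rw [norm_mul, norm_mul, Complex.norm_real, Real.norm_of_nonneg h.d_nonneg]; norm_num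

theorem IsRoot.norm_y (h : IsRoot c d p q) : ‖2 * (c : ℂ) * q‖ = 2 * c * ‖q‖ := by
  rw [norm_mul, norm_mul, Complex.norm_real, Real.norm_of_nonneg h.c_nonneg]; norm_num

/-- All four quantities are nonnegative, so this identity converts every comparison of `|a - b|`
with `‖x‖ + ‖y‖` into one of the two gains. -/
theorem IsRoot.sq_sub_sq (h : IsRoot c d p q) :
    |c ^ 2 + Complex.normSq q - (d ^ 2 + Complex.normSq p)| ^ 2 -
      (‖2 * (d : ℂ) * p‖ + ‖2 * (c : ℂ) * q‖) ^ 2 =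
      axisGain c d p q ^ 2 - planeGain c d p q ^ 2 := by
  rw [sq_abs, h.norm_x, h.norm_y, axisGain, planeGain, ← Complex.sq_norm, ← Complex.sq_norm]
  ring

theorem IsRoot.plane_lt_axis_iff (h : IsRoot c d p q) :
    ‖2 * (d : ℂ) * p‖ + ‖2 * (c : ℂ) * q‖ <
      |c ^ 2 + Complex.normSq q - (d ^ 2 + Complex.normSq p)| ↔
      planeGain c d p q < axisGain c d p q := by
  rw [← sq_lt_sq₀ (by positivity) (abs_nonneg _),
    ← sq_lt_sq₀ h.planeGain_nonneg h.axisGain_nonneg, ← sub_pos, h.sq_sub_sq, sub_pos]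

theorem IsRoot.axis_lt_plane_iff (h : IsRoot c d p q) :
    |c ^ 2 + Complex.normSq q - (d ^ 2 + Complex.normSq p)| <
      ‖2 * (d : ℂ) * p‖ + ‖2 * (c : ℂ) * q‖ ↔ axisGain c d p q < planeGain c d p q := by
  rw [← sq_lt_sq₀ (abs_nonneg _) (by positivity),
    ← sq_lt_sq₀ h.axisGain_nonneg h.planeGain_nonneg, ← sub_neg, h.sq_sub_sq, sub_neg]

/-- The eigenvalues of `ρ` are `(d ∓ |p|)²` and `(c ∓ |q|)²`, so the products under the roots are
perfect squares. -/
theorem IsRoot.sqrt_add_sqrt_axis (h : IsRoot c d p q) :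
    √((d ^ 2 + Complex.normSq p - ‖2 * (d : ℂ) * p‖) *
        (d ^ 2 + Complex.normSq p + ‖2 * (d : ℂ) * p‖)) +
      √((c ^ 2 + Complex.normSq q - ‖2 * (c : ℂ) * q‖) *
        (c ^ 2 + Complex.normSq q + ‖2 * (c : ℂ) * q‖)) = axisGain c d p q := by
  have hp := h.normSq_p_le
  have hq := h.normSq_q_le
  rw [h.norm_x, h.norm_y, axisGain]
  rw [← Complex.sq_norm] at hp hq ⊢
  rw [← Complex.sq_norm]
  rw [show (d ^ 2 + ‖p‖ ^ 2 - 2 * d * ‖p‖) * (d ^ 2 + ‖p‖ ^ 2 + 2 * d * ‖p‖) =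
      (d ^ 2 - ‖p‖ ^ 2) ^ 2 by ring,
    show (c ^ 2 + ‖q‖ ^ 2 - 2 * c * ‖q‖) * (c ^ 2 + ‖q‖ ^ 2 + 2 * c * ‖q‖) =
      (c ^ 2 - ‖q‖ ^ 2) ^ 2 by ring, Real.sqrt_sq (by linarith), Real.sqrt_sq (by linarith)]
  ring

theorem IsRoot.sqrt_add_sqrt_plane (h : IsRoot c d p q) :
    √((d ^ 2 + Complex.normSq p + ‖2 * (d : ℂ) * p‖) *
        (c ^ 2 + Complex.normSq q + ‖2 * (c : ℂ) * q‖)) +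
      √((d ^ 2 + Complex.normSq p - ‖2 * (d : ℂ) * p‖) *
        (c ^ 2 + Complex.normSq q - ‖2 * (c : ℂ) * q‖)) = planeGain c d p q := by
  have hp := h.norm_p_le
  have hq := h.norm_q_le
  have hc := h.c_nonneg
  have hd := h.d_nonneg
  rw [h.norm_x, h.norm_y, planeGain, ← Complex.sq_norm, ← Complex.sq_norm]
  rw [show (d ^ 2 + ‖p‖ ^ 2 + 2 * d * ‖p‖) * (c ^ 2 + ‖q‖ ^ 2 + 2 * c * ‖q‖) =
      ((d + ‖p‖) * (c + ‖q‖)) ^ 2 by ring,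
    show (d ^ 2 + ‖p‖ ^ 2 - 2 * d * ‖p‖) * (c ^ 2 + ‖q‖ ^ 2 - 2 * c * ‖q‖) =
      ((d - ‖p‖) * (c - ‖q‖)) ^ 2 by ring, Real.sqrt_sq (by positivity),
    Real.sqrt_sq (mul_nonneg (by linarith) (by linarith))]
  ring

theorem IsRoot.mul_eq_zero_iff (h : IsRoot c d p q) :
    2 * (d : ℂ) * p * (2 * c * q) = 0 ↔ p * q = 0 := by
  constructor
  · intro h0
    have h1 : (4 : ℂ) * ((c * d : ℝ) * (p * q)) = 0 := by push_cast; linear_combination h0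
    rcases mul_eq_zero.1 ((mul_eq_zero.1 h1).resolve_left (by norm_num)) with h2 | h2
    · exact h.mul_eq_zero_of_cd (by exact_mod_cast h2)
    · exact h2
  · intro h0
    linear_combination 4 * (c * d : ℂ) * h0

theorem IsRoot.phase (h : IsRoot c d p q) (hxy : 2 * (d : ℂ) * p * (2 * c * q) ≠ 0) {φ : ℝ}
    (hφ : 2 * (d : ℂ) * p * (2 * c * q) =
      (‖2 * (d : ℂ) * p * (2 * c * q)‖ : ℂ) * Complex.exp (φ * Complex.I)) :
    p * q = ((‖p‖ * ‖q‖ : ℝ) : ℂ) * Complex.exp (φ * Complex.I) := by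
  have hcd : (4 : ℂ) * (c * d) ≠ 0 := by
    intro h0
    exact hxy (by linear_combination (p * q) * h0)
  rw [norm_mul (2 * (d : ℂ) * p), h.norm_x, h.norm_y] at hφ
  refine mul_left_cancel₀ hcd ?_
  push_cast at hφ ⊢
  linear_combination hφ

end Translation

/-! ### The three regimes for the root parameters. -/

section Cases

variable {c d : ℝ} {p q : ℂ}

theorem IsRoot.optimalMeasurements_axis (h : IsRoot c d p q)
    (hlt : planeGain c d p q < axisGain c d p q) :
    optimalMeasurements (squaredX c d p q) = {{Matrix.single 0 0 1, Matrix.single 1 1 1}} := by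
  rw [h.optimalMeasurements_eq (h.isMaxGain_of_le hlt.le), ← blochPair_axis]
  ext M
  simp only [Set.mem_ofPred_eq, Set.mem_singleton_iff]
  constructor
  · rintro ⟨ζ, z, hu, hg, rfl⟩
    have h0 := (h.gain_eq_iff_of_lt hlt hu).1 hg
    subst h0
    have hz : z ^ 2 = 1 ^ 2 := by simpa using hu
    rcases sq_eq_sq_iff_eq_or_eq_neg.1 hz with rfl | rfl
    · rfl
    · rw [← blochPair_neg, neg_zero, neg_neg]
  · rintro rfl
    have hu : Complex.normSq 0 + (1 : ℝ) ^ 2 = 1 := by simp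
    exact ⟨0, 1, hu, (h.gain_eq_iff_of_lt hlt hu).2 rfl, rfl⟩

theorem IsRoot.optimalMeasurements_plane (h : IsRoot c d p q)
    (hlt : axisGain c d p q < planeGain c d p q) (hpq : p * q ≠ 0) {φ : ℝ}
    (hφ : p * q = ((‖p‖ * ‖q‖ : ℝ) : ℂ) * Complex.exp (φ * Complex.I)) :
    optimalMeasurements (squaredX c d p q) =
      {blochMeasurement ![Real.cos (φ / 2), -Real.sin (φ / 2), 0]} := by
  rw [h.optimalMeasurements_eq (h.isMaxGain_of_ge hlt.le)]
  ext M
  simp only [Set.mem_ofPred_eq, Set.mem_singleton_iff]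
  constructor
  · rintro ⟨ζ, z, hu, hg, rfl⟩
    obtain ⟨rfl, hal⟩ := (h.gain_eq_iff_of_gt hlt hu).1 hg
    obtain ⟨t, ht⟩ := hal.exists_eq hpq hφ
    exact blochPair_equator_of_eq ht (by simpa using hu)
  · rintro rfl
    have hal := aligned_mul_exp hφ 1
    have hn := normSq_ofReal_mul_exp 1 (φ / 2)
    rw [Complex.ofReal_one, one_mul] at hal hn
    have hu : Complex.normSq (Complex.exp ((φ / 2 : ℝ) * Complex.I)) + (0 : ℝ) ^ 2 = 1 := by
      rw [hn]; norm_num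
    exact ⟨_, 0, hu, (h.gain_eq_iff_of_gt hlt hu).2 ⟨rfl, hal⟩, blochMeasurement_equator _⟩

theorem IsRoot.optimalMeasurements_plane_of_mul_eq_zero (h : IsRoot c d p q)
    (hlt : axisGain c d p q < planeGain c d p q) (hpq : p * q = 0) :
    optimalMeasurements (squaredX c d p q) =
      {M | ∃ φ ∈ Set.Ico 0 (2 * Real.pi),
        M = blochMeasurement ![Real.cos (φ / 2), -Real.sin (φ / 2), 0]} := by
  rw [h.optimalMeasurements_eq (h.isMaxGain_of_ge hlt.le)]
  ext M
  simp only [Set.mem_ofPred_eq]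
  constructor
  · rintro ⟨ζ, z, hu, hg, rfl⟩
    obtain ⟨rfl, -⟩ := (h.gain_eq_iff_of_gt hlt hu).1 hg
    obtain ⟨φ, hφ, t, ht⟩ := exists_halfAngle ζ
    exact ⟨φ, hφ, blochPair_equator_of_eq ht (by simpa using hu)⟩
  · rintro ⟨φ, -, rfl⟩
    have hn := normSq_ofReal_mul_exp 1 (φ / 2)
    rw [Complex.ofReal_one, one_mul] at hn
    have hu : Complex.normSq (Complex.exp ((φ / 2 : ℝ) * Complex.I)) + (0 : ℝ) ^ 2 = 1 := by
      rw [hn]; norm_num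
    exact ⟨_, 0, hu, (h.gain_eq_iff_of_gt hlt hu).2 ⟨rfl, aligned_of_mul_eq_zero hpq _⟩,
      blochMeasurement_equator _⟩

theorem IsRoot.optimalMeasurements_boundary (h : IsRoot c d p q)
    (heq : axisGain c d p q = planeGain c d p q) (hpq : p * q ≠ 0) {φ : ℝ}
    (hφ : p * q = ((‖p‖ * ‖q‖ : ℝ) : ℂ) * Complex.exp (φ * Complex.I)) :
    optimalMeasurements (squaredX c d p q) =
      {M | ∃ θ ∈ Set.Icc 0 Real.pi, M = blochMeasurement ![Real.sin θ * Real.cos (φ / 2),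
        -(Real.sin θ * Real.sin (φ / 2)), Real.cos θ]} := by
  rw [h.optimalMeasurements_eq (h.isMaxGain_of_ge heq.le)]
  ext M
  simp only [Set.mem_ofPred_eq]
  constructor
  · rintro ⟨ζ, z, hu, hg, rfl⟩
    obtain ⟨t, ht⟩ := ((h.gain_eq_iff_of_eq heq hu).1 hg).exists_eq hpq hφ
    exact blochPair_spherical_of_eq ht hu
  · rintro ⟨θ, -, rfl⟩
    have hu : Complex.normSq (Real.sin θ * Complex.exp ((φ / 2 : ℝ) * Complex.I)) +
        Real.cos θ ^ 2 = 1 := by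
      rw [normSq_ofReal_mul_exp, Real.sin_sq_add_cos_sq]
    exact ⟨_, _, hu, (h.gain_eq_iff_of_eq heq hu).2 (aligned_mul_exp hφ _),
      blochMeasurement_spherical _ _⟩

theorem IsRoot.optimalMeasurements_boundary_of_mul_eq_zero (h : IsRoot c d p q)
    (heq : axisGain c d p q = planeGain c d p q) (hpq : p * q = 0) :
    optimalMeasurements (squaredX c d p q) =
      {M | ∃ θ ∈ Set.Icc 0 Real.pi, ∃ φ ∈ Set.Ico 0 (2 * Real.pi),
        M = blochMeasurement ![Real.sin θ * Real.cos (φ / 2),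
          -(Real.sin θ * Real.sin (φ / 2)), Real.cos θ]} := by
  rw [h.optimalMeasurements_eq (h.isMaxGain_of_ge heq.le)]
  ext M
  simp only [Set.mem_ofPred_eq]
  constructor
  · rintro ⟨ζ, z, hu, -, rfl⟩
    obtain ⟨φ, hφ, t, ht⟩ := exists_halfAngle ζ
    obtain ⟨θ, hθ, hM⟩ := blochPair_spherical_of_eq ht hu
    exact ⟨θ, hθ, φ, hφ, hM⟩
  · rintro ⟨θ, -, φ, -, rfl⟩
    have hu : Complex.normSq (Real.sin θ * Complex.exp ((φ / 2 : ℝ) * Complex.I)) +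
        Real.cos θ ^ 2 = 1 := by
      rw [normSq_ofReal_mul_exp, Real.sin_sq_add_cos_sq]
    exact ⟨_, _, hu, (h.gain_eq_iff_of_eq heq hu).2 (aligned_of_mul_eq_zero hpq _),
      blochMeasurement_spherical _ _⟩

theorem IsRoot.infinite_closestStates_plane (h : IsRoot c d p q)
    (hlt : axisGain c d p q < planeGain c d p q) (hpq : p * q = 0) (h0 : ¬(p = 0 ∧ q = 0)) :
    (closestStates (squaredX c d p q)).Infinite := by
  have hu : ∀ t : ℝ, Complex.normSq (Complex.exp ((t : ℝ) * Complex.I)) + (0 : ℝ) ^ 2 = 1 := by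
    intro t
    have hn := normSq_ofReal_mul_exp 1 t
    rw [Complex.ofReal_one, one_mul] at hn
    rw [hn]; norm_num
  exact h.infinite_closestStates (h.isMaxGain_of_ge hlt.le) h0
    (Set.Ioo_infinite Real.pi_pos) (fun t => Complex.exp ((t : ℝ) * Complex.I)) (fun _ => 0)
    (fun t _ => hu t) (fun t _ => Complex.exp_ne_zero _)
    (fun t _ => aligned_of_mul_eq_zero hpq _)
    (fun t _ => (h.gain_eq_iff_of_gt hlt (hu t)).2 ⟨rfl, aligned_of_mul_eq_zero hpq _⟩)
    (fun t ht s hs κ hκ => eq_of_bloch_equator ht hs hκ)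

theorem Aligned.ofReal_mul {ω : ℂ} (h : Aligned p q ω) (t : ℝ) : Aligned p q (t * ω) := by
  rw [Aligned, Complex.star_def] at h ⊢
  rw [map_mul, mul_pow, Complex.conj_ofReal, Complex.normSq_mul,
    Complex.normSq_ofReal]
  push_cast at h ⊢
  linear_combination (t : ℂ) ^ 2 * h

theorem IsRoot.infinite_closestStates_boundary (h : IsRoot c d p q)
    (heq : axisGain c d p q = planeGain c d p q) (h0 : ¬(p = 0 ∧ q = 0)) :
    (closestStates (squaredX c d p q)).Infinite := by
  obtain ⟨ω, hω, hal⟩ := exists_aligned p q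
  have hω0 : ω ≠ 0 := by
    rintro rfl
    simp at hω
  have hu : ∀ t : ℝ, Complex.normSq (Real.sin t * ω) + Real.cos t ^ 2 = 1 := by
    intro t
    rw [Complex.normSq_mul, Complex.normSq_ofReal, hω, mul_one, ← sq, Real.sin_sq_add_cos_sq]
  refine h.infinite_closestStates (h.isMaxGain_of_ge heq.le) h0
    (Set.Ioo_infinite Real.pi_pos) (fun t => Real.sin t * ω) (fun t => Real.cos t)
    (fun t _ => hu t) (fun t ht => mul_ne_zero ?_ hω0) (fun t _ => hal.ofReal_mul _)
    (fun t _ => (h.gain_eq_iff_of_eq heq (hu t)).2 (hal.ofReal_mul _))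
    (fun t ht s hs κ hκ => eq_of_bloch_spherical hω0 ht hs hκ)
  exact_mod_cast (Real.sin_pos_of_mem_Ioo ht).ne'

theorem IsRoot.exists_isMaxGain (h : IsRoot c d p q) : ∃ m, IsMaxGain c d p q m := by
  rcases le_total (planeGain c d p q) (axisGain c d p q) with hle | hle
  · exact ⟨_, h.isMaxGain_of_le hle⟩
  · exact ⟨_, h.isMaxGain_of_ge hle⟩

theorem IsRoot.maxFidelity_eq (h : IsRoot c d p q) {m : ℝ} (hm : IsMaxGain c d p q m) :
    maxFidelity (squaredX c d p q) = 1 / 2 + 2 * m :=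
  (h.isGreatest_fidelity hm).csSup_eq

theorem IsRoot.geometricDiscord_eq (h : IsRoot c d p q) {m : ℝ} (hm : IsMaxGain c d p q m) :
    geometricDiscord (squaredX c d p q) = 2 * (1 - √(1 / 2 + 2 * m)) :=
  (h.isLeast_buresDist hm).csInf_eq

end Cases

theorem exists_isRoot_of_isState {a b : ℝ} {x y : ℂ} (h : IsState (xState a b x y)) :
    ∃ c d p q, IsRoot c d p q ∧ a = c ^ 2 + Complex.normSq q ∧ b = d ^ 2 + Complex.normSq p ∧
      x = 2 * d * p ∧ y = 2 * c * q := by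
  obtain ⟨hx, hy⟩ := norm_le_of_xState_posSemidef h.1
  obtain ⟨c, q, hq, ha, hy'⟩ := exists_block_root hy
  obtain ⟨d, p, hp, hb, hx'⟩ := exists_block_root hx
  refine ⟨c, d, p, q, ⟨hp, hq, ?_⟩, ha, hb, hx', hy'⟩
  have := h.2
  rw [trace_xState] at this
  have h2 : 2 * (a + b) = 1 := by exact_mod_cast this
  linarith

end QDiscord

theorem mainTheorem1 (a b : ℝ) (x y : ℂ) (ρ : Op2) (hρ : ρ = xState a b x y)
    (hstate : IsState ρ) (p₁ p₂ p₃ p₄ : ℝ)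
    (hp₁ : p₁ = b - ‖x‖) (hp₂ : p₂ = b + ‖x‖) (hp₃ : p₃ = a - ‖y‖) (hp₄ : p₄ = a + ‖y‖) :
    -- the numbers `pᵢ` are the eigenvalues of `ρ`
    ρ.charpoly = (Polynomial.X - Polynomial.C (p₁ : ℂ)) * (Polynomial.X - Polynomial.C (p₂ : ℂ)) *
      (Polynomial.X - Polynomial.C (p₃ : ℂ)) * (Polynomial.X - Polynomial.C (p₄ : ℂ)) ∧
    -- maximal fidelity and geometric discord are attained, and related by the stated formula
    IsGreatest (fidelity ρ '' aClassicalStates) (maxFidelity ρ) ∧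
    IsGreatest (Set.range (optSuccessProb ρ)) (maxFidelity ρ) ∧
    IsLeast ((fun σ => buresDist ρ σ ^ 2) '' aClassicalStates) (geometricDiscord ρ) ∧
    geometricDiscord ρ = 2 * (1 - √(maxFidelity ρ)) ∧
    -- a basis is optimal iff some closest `A`-classical state is classical in that basis
    (∀ α : QubitBasis, IsOptimalBasis ρ α ↔ ∃ σ ∈ closestStates ρ, IsAClassicalIn α σ) ∧
    -- first case
    (‖x‖ + ‖y‖ < |a - b| →
      maxFidelity ρ = 1 / 2 + √(p₁ * p₂) + √(p₃ * p₄) ∧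
      optimalMeasurements ρ = {{Matrix.single 0 0 1, Matrix.single 1 1 1}}) ∧
    -- second case
    (|a - b| < ‖x‖ + ‖y‖ →
      maxFidelity ρ = 1 / 2 + √(p₂ * p₄) + √(p₁ * p₃) ∧
      (x * y ≠ 0 → ∀ φ : ℝ, x * y = (‖x * y‖ : ℂ) * Complex.exp (φ * Complex.I) →
        optimalMeasurements ρ =
          {blochMeasurement ![Real.cos (φ / 2), -Real.sin (φ / 2), 0]}) ∧
      (x * y = 0 →
        optimalMeasurements ρ =
          {M | ∃ φ ∈ Set.Ico 0 (2 * Real.pi),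
            M = blochMeasurement ![Real.cos (φ / 2), -Real.sin (φ / 2), 0]} ∧
        (closestStates ρ).Infinite)) ∧
    -- boundary case
    (|a - b| = ‖x‖ + ‖y‖ →
      maxFidelity ρ = 1 / 2 + √(p₁ * p₂) + √(p₃ * p₄) ∧
      maxFidelity ρ = 1 / 2 + √(p₂ * p₄) + √(p₁ * p₃) ∧
      (x * y ≠ 0 → ∀ φ : ℝ, x * y = (‖x * y‖ : ℂ) * Complex.exp (φ * Complex.I) →
        optimalMeasurements ρ =
          {M | ∃ θ ∈ Set.Icc 0 Real.pi,
            M = blochMeasurement ![Real.sin θ * Real.cos (φ / 2),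
              -(Real.sin θ * Real.sin (φ / 2)), Real.cos θ]}) ∧
      (x * y = 0 →
        optimalMeasurements ρ =
          {M | ∃ θ ∈ Set.Icc 0 Real.pi, ∃ φ ∈ Set.Ico 0 (2 * Real.pi),
            M = blochMeasurement ![Real.sin θ * Real.cos (φ / 2),
              -(Real.sin θ * Real.sin (φ / 2)), Real.cos θ]}) ∧
      (¬(x = 0 ∧ y = 0) → (closestStates ρ).Infinite)) := by
  subst hρ
  obtain ⟨c, d, p, q, h, rfl, rfl, rfl, rfl⟩ := exists_isRoot_of_isState hstate
  subst hp₁ hp₂ hp₃ hp₄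
  obtain ⟨m, hm⟩ := h.exists_isMaxGain
  have hS := h.sqrt_add_sqrt_axis
  have hP := h.sqrt_add_sqrt_plane
  refine ⟨charpoly_xState _ _ _ _, ?_, ?_, ?_, ?_, h.isOptimalBasis_iff_closest hm, ?_, ?_, ?_⟩
  · exact h.maxFidelity_eq hm ▸ h.isGreatest_fidelity hm
  · exact h.maxFidelity_eq hm ▸ h.isGreatest_optSuccessProb hm
  · exact h.geometricDiscord_eq hm ▸ h.isLeast_buresDist hm
  · exact (h.geometricDiscord_eq hm).trans (by rw [← h.maxFidelity_eq hm]; rfl)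
  · intro hlt
    have hlt' := h.plane_lt_axis_iff.1 hlt
    refine ⟨(h.maxFidelity_eq (h.isMaxGain_of_le hlt'.le)).trans ?_,
      h.optimalMeasurements_axis hlt'⟩
    rw [add_assoc, hS]
    ring
  · intro hlt
    have hlt' := h.axis_lt_plane_iff.1 hlt
    refine ⟨(h.maxFidelity_eq (h.isMaxGain_of_ge hlt'.le)).trans ?_, ?_, ?_⟩
    · rw [add_assoc, hP]
      ring
    · intro hxy φ hφ
      exact h.optimalMeasurements_plane hlt' (fun h0 => hxy (h.mul_eq_zero_iff.2 h0))
        (h.phase hxy hφ)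
    · intro hxy
      have hpq := h.mul_eq_zero_iff.1 hxy
      refine ⟨h.optimalMeasurements_plane_of_mul_eq_zero hlt' hpq,
        h.infinite_closestStates_plane hlt' hpq ?_⟩
      -- Here `x = y = 0` is impossible: it would make `|a - b|` negative.
      rintro ⟨rfl, rfl⟩
      simp only [mul_zero, norm_zero, add_zero] at hlt
      exact absurd hlt (abs_nonneg _).not_gt
  · intro heq
    -- A strict inequality between the gains in either direction would give a strict one between `|a
    -- - b|` and `‖x‖ + ‖y‖`.
    have heq' : axisGain c d p q = planeGain c d p q :=
      le_antisymm (not_lt.1 fun h' => (h.plane_lt_axis_iff.2 h').ne' heq)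
        (not_lt.1 fun h' => (h.axis_lt_plane_iff.2 h').ne heq)
    have hF := h.maxFidelity_eq (h.isMaxGain_of_ge heq'.le)
    refine ⟨hF.trans ?_, hF.trans ?_, ?_, ?_, ?_⟩
    · rw [add_assoc, hS, heq']
      ring
    · rw [add_assoc, hP]
      ring
    · intro hxy φ hφ
      exact h.optimalMeasurements_boundary heq' (fun h0 => hxy (h.mul_eq_zero_iff.2 h0))
        (h.phase hxy hφ)
    · intro hxy
      exact h.optimalMeasurements_boundary_of_mul_eq_zero heq' (h.mul_eq_zero_iff.1 hxy)
    · intro hxy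
      refine h.infinite_closestStates_boundary heq' fun h0 => hxy ?_
      simp [h0.1, h0.2]
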